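/- Let $G$ be a connected (finite-dimensional, real) Lie group with Lie algebra $\mathfrak g$, let $H\subset G$ be a closed subgroup with Lie algebra $\mathfrak h$, and let $\mathfrak m\subset\mathfrak g$ be a linear subspace with $\mathfrak g=\mathfrak h\oplus\mathfrak m$ and $\mathrm{Ad}_a(\mathfrak m)=\mathfrak m$ for all $a\in H$. Let $M=G/H$ with its quotient smooth structure (the one for which $G\to G/H$ is a smooth submersion), $\bar e=H\in M$, $\lambda_g(xH)=gxH$, and $g\cdot\alpha=\lambda_{g^{-1}}^*\alpha$ for $g\in G$ and $\alpha\in\Omega^1(M)$. Let $\pi$ be a $G$-invariant Poisson bivector field on $M$, and let $\alpha\mapsto\alpha^\#$ be the bundle map $T^*M\to TM$ with $\langle\beta,\alpha^\#\rangle=\pi(\alpha,\beta)$. A contravariant connection on $(M,\pi)$ is an $\mathbb R$-bilinear map $D:\Omega^1(M)\times\Omega^1(M)\to\Omega^1(M)$, $(\alpha,\beta)\mapsto D_\alpha\beta$, such that $D_{f\alpha}\beta=fD_\alpha\beta$ and $D_\alpha(f\beta)=(\alpha^\#\cdot f)\beta+fD_\alpha\beta$ for all $f\in C^\infty(M)$;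 it is $G$-invariant if $g\cdot D_\alpha\beta=D_{g\cdot\alpha}(g\cdot\beta)$ for all $g\in G$ and $\alpha,\beta\in\Omega^1(M)$. A bilinear map $\mathfrak b:\mathfrak m^*\times\mathfrak m^*\to\mathfrak m^*$ is $\mathrm{Ad}(H)$-invariant if $\mathrm{Ad}_a^*\mathfrak b(\eta,\xi)=\mathfrak b(\mathrm{Ad}_a^*\eta,\mathrm{Ad}_a^*\xi)$ for all $a\in H$ and $\eta,\xi\in\mathfrak m^*$, where $\mathrm{Ad}_a^*\eta=\eta\circ\mathrm{Ad}_a|_{\mathfrak m}$. For $u\in\mathfrak g$ let $u^*_{\bar e}=\frac{d}{dt}\big|_{t=0}\exp(-tu)H\in T_{\bar e}M$. Identify $\mathfrak m$ with $T_{\bar e}M$ through $u\mapsto u^*_{\bar e}$, and accordingly $T^*_{\bar e}M$ with $\mathfrak m^*$ through $\alpha\mapsto(u\mapsto\alpha(u^*_{\bar e}))$. For $\beta\in\Omega^1(M)$ let $F^\beta:G\to\mathfrak m^*$ be the function $F^\beta(g)=(g^{-1}\cdot\beta)_{\bar e}=(T_{\bar e}\lambda_g)^*\beta_{gH}$, and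 for $u\in\mathfrak m$ put $u\cdot F^\beta=(dF^\beta)_e(-u)\in\mathfrak m^*$. Then there is a bijection $D\mapsto\mathfrak b$ from the set of $G$-invariant contravariant connections on $(M,\pi)$ onto the set of $\mathrm{Ad}(H)$-invariant bilinear maps $\mathfrak b:\mathfrak m^*\times\mathfrak m^*\to\mathfrak m^*$, such that, for all $\alpha,\beta\in\Omega^1(M)$, $$(D_\alpha\beta)(\bar e)=\mathfrak b(\alpha_{\bar e},\beta_{\bar e})+\alpha_{\bar e}^\#\cdot F^\beta .$$ -/

import Mathlib

open scoped Manifold ContDiff Topology Bundle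

noncomputable section

set_option linter.unusedSectionVars false

namespace PoissonHomogeneous

section LocalSection

variable {E F : Type*} [NormedAddCommGroup E] [NormedSpace ℝ E]
  [NormedAddCommGroup F] [NormedSpace ℝ F] [FiniteDimensional ℝ F]
  {N : Type*} [TopologicalSpace N] [ChartedSpace E N] [IsManifold 𝓘(ℝ, E) ∞ N]
  {M : Type*} [TopologicalSpace M] [ChartedSpace F M] [IsManifold 𝓘(ℝ, F) ∞ M]

/-- A smooth map with surjective derivative at `x` has a smooth local section through `x`. -/
theorem exists_contMDiffAt_localSection {f : N → M} {x : N}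
    (hf : ContMDiffAt 𝓘(ℝ, E) 𝓘(ℝ, F) ∞ f x)
    (hs : Function.Surjective (mfderiv 𝓘(ℝ, E) 𝓘(ℝ, F) f x)) :
    ∃ σ : M → N, ContMDiffAt 𝓘(ℝ, F) 𝓘(ℝ, E) ∞ σ (f x) ∧ σ (f x) = x ∧
      ∀ᶠ y in 𝓝 (f x), f (σ y) = y := by
  have : CompleteSpace F := FiniteDimensional.complete ℝ F
  set a : E := extChartAt 𝓘(ℝ, E) x x with ha
  set w : E → F := writtenInExtChartAt 𝓘(ℝ, E) 𝓘(ℝ, F) x f with hw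
  have hw1 : ContDiffAt ℝ ∞ w a := by
    have := (contMDiffAt_iff.1 hf).2
    simpa using! this
  have hwd : HasFDerivAt w (mfderiv 𝓘(ℝ, E) 𝓘(ℝ, F) f x) a := by
    have h := (hf.mdifferentiableAt (by simp)).hasMFDerivAt.2
    exact hasFDerivWithinAt_univ.1 (by simpa using! h)
  obtain ⟨L, hL⟩ : ∃ L : E →L[ℝ] F, L = mfderiv 𝓘(ℝ, E) 𝓘(ℝ, F) f x := ⟨_, rfl⟩
  have hLs : Function.Surjective L := by rw [hL]; exact hs
  obtain ⟨A, hA⟩ := L.exists_rightInverse_of_surjective (LinearMap.range_eq_top.2 hLs)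
  replace hwd : HasFDerivAt w L a := by rw [hL]; exact hwd
  let k : F → F := fun v => w (a + A v)
  have hin : ContDiffAt ℝ ∞ (fun v : F => a + A v) 0 := by fun_prop
  have hk : ContDiffAt ℝ ∞ k 0 := by
    refine ContDiffAt.comp (0 : F) (g := w) (f := fun v => a + A v) ?_ hin
    simpa using hw1
  have hkd : HasFDerivAt k ((ContinuousLinearEquiv.refl ℝ F : F ≃L[ℝ] F) : F →L[ℝ] F) 0 := by
    have h1 : HasFDerivAt (fun v : F => a + A v) A 0 := A.hasFDerivAt.const_add a
    have h2 := HasFDerivAt.comp (g := w) (f := fun v : F => a + A v) (0 : F)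
      (g' := L) (by rw [map_zero, add_zero]; exact hwd) h1
    have h3 : L.comp A =
      ((ContinuousLinearEquiv.refl ℝ F : F ≃L[ℝ] F) : F →L[ℝ] F) := by
      rw [hA]; rfl
    rw [← h3]; exact h2
  let q := hk.localInverse hkd (by simp)
  have hk0 : k 0 = extChartAt 𝓘(ℝ, F) (f x) (f x) := by simp [k, hw, ha]
  have hq : ContDiffAt ℝ ∞ q (k 0) := hk.to_localInverse hkd (by simp)
  have hq0 : q (k 0) = 0 := hk.localInverse_apply_image hkd (by simp)
  have hkq : ∀ᶠ z in 𝓝 (k 0), k (q z) = z :=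
    (hk.hasStrictFDerivAt' hkd (by simp)).eventually_right_inverse
  let c : M → E := fun y => a + A (q (extChartAt 𝓘(ℝ, F) (f x) y))
  have hcx : c (f x) = a := by
    have : q (extChartAt 𝓘(ℝ, F) (f x) (f x)) = 0 := by rw [← hk0]; exact hq0
    simp only [c, this, map_zero, add_zero]
  have hq' : ContMDiffAt 𝓘(ℝ, F) 𝓘(ℝ, F) ∞ q (extChartAt 𝓘(ℝ, F) (f x) (f x)) := by
    rw [← hk0]; exact hq.contMDiffAt
  have hqc : ContMDiffAt 𝓘(ℝ, F) 𝓘(ℝ, F) ∞ (fun y => q (extChartAt 𝓘(ℝ, F) (f x) y)) (f x) :=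
    ContMDiffAt.comp (f x) hq' contMDiffAt_extChartAt
  have hc : ContMDiffAt 𝓘(ℝ, F) 𝓘(ℝ, E) ∞ c (f x) := by
    have hin' : ContDiff ℝ ∞ (fun v : F => a + A v) := by fun_prop
    exact ContMDiffAt.comp (g := fun v : F => a + A v) (f x) (hin'.contMDiff _) hqc
  have hsymm : ContMDiffAt 𝓘(ℝ, E) 𝓘(ℝ, E) ∞ (extChartAt 𝓘(ℝ, E) x).symm (c (f x)) := by
    rw [hcx]
    exact (contMDiffOn_extChartAt_symm x).contMDiffAt (extChartAt_target_mem_nhds x)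
  refine ⟨fun y => (extChartAt 𝓘(ℝ, E) x).symm (c y), ContMDiffAt.comp (f x) hsymm hc,
    by simp [hcx, ha], ?_⟩
  have hσ : ContinuousAt (fun y => (extChartAt 𝓘(ℝ, E) x).symm (c y)) (f x) :=
    (ContMDiffAt.comp (f x) hsymm hc).continuousAt
  have e1 : ∀ᶠ y in 𝓝 (f x), f ((extChartAt 𝓘(ℝ, E) x).symm (c y)) ∈
      (extChartAt 𝓘(ℝ, F) (f x)).source := by
    have h : ContinuousAt (fun y => f ((extChartAt 𝓘(ℝ, E) x).symm (c y))) (f x) := by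
      refine ContinuousAt.comp (g := f) ?_ hσ
      simpa [hcx, ha] using hf.continuousAt
    apply h.preimage_mem_nhds
    simpa [hcx, ha] using extChartAt_source_mem_nhds (I := 𝓘(ℝ, F)) (f x)
  have e2 : ∀ᶠ y in 𝓝 (f x), k (q (extChartAt 𝓘(ℝ, F) (f x) y)) = extChartAt 𝓘(ℝ, F) (f x) y := by
    rw [hk0] at hkq
    exact (continuousAt_extChartAt (f x)).eventually hkq
  filter_upwards [e1, e2, extChartAt_source_mem_nhds (I := 𝓘(ℝ, F)) (f x)] with y h1 h2 h3
  apply (extChartAt 𝓘(ℝ, F) (f x)).injOn h1 h3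
  exact h2

end LocalSection

section Manifold

variable (F : Type*) [NormedAddCommGroup F] [NormedSpace ℝ F]
  (M : Type*) [TopologicalSpace M] [ChartedSpace F M] [IsManifold 𝓘(ℝ, F) ∞ M]

/-- The fibre of the cotangent bundle at `x`. -/
abbrev CotangentSpace (x : M) : Type _ := TangentSpace 𝓘(ℝ, F) x →L[ℝ] ℝ

/-- Smooth differential one-forms on `M`: smooth sections of the cotangent bundle. -/
abbrev OneForm : Type _ :=
  ContMDiffSection 𝓘(ℝ, F) (F →L[ℝ] ℝ) ∞ (fun x : M => CotangentSpace F M x)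

variable {F M}

/-- The product `f • α` of a smooth function and a one-form. -/
def OneForm.smul (f : C^∞⟮𝓘(ℝ, F), M; ℝ⟯) (α : OneForm F M) : OneForm F M where
  toFun x := f x • α x
  contMDiff_toFun := f.contMDiff.smul_section α.contMDiff

/-- The differential of a real-valued function at a point. -/
def dAt (f : M → ℝ) (x : M) : CotangentSpace F M x := mfderiv 𝓘(ℝ, F) 𝓘(ℝ, ℝ) f x

/-- The pullback `φ^* α`, with `(φ^* α)_x = α_{φ(x)} ∘ T_x φ`. -/
def OneForm.pullback (φ : C^∞⟮𝓘(ℝ, F), M; 𝓘(ℝ, F), M⟯) (α : OneForm F M) : OneForm F M where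
  toFun x := (α (φ x)).comp (mfderiv 𝓘(ℝ, F) 𝓘(ℝ, F) φ x)
  contMDiff_toFun := by
    intro x₀
    have h1 := (contMDiffAt_hom_bundle _).1 (α.contMDiff (φ x₀))
    have h2 := (φ.contMDiff x₀).mfderiv_const (m := ∞) (n := ∞) (by simp)
    have h3 := ContMDiffAt.comp x₀ h1.2 (φ.contMDiff x₀)
    refine (contMDiffAt_hom_bundle _).2 ⟨contMDiffAt_id, ?_⟩
    refine (h3.clm_comp h2).congr_of_eventuallyEq ?_
    have e1 := φ.contMDiff.continuous.continuousAt.preimage_mem_nhds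
      ((trivializationAt F (TangentSpace 𝓘(ℝ, F)) (φ x₀)).open_baseSet.mem_nhds
        (FiberBundle.mem_baseSet_trivializationAt' (φ x₀)))
    filter_upwards [e1] with x hx
    ext v
    have key := (trivializationAt F (TangentSpace 𝓘(ℝ, F)) (φ x₀)).symmL_continuousLinearMapAt
      (R := ℝ) hx
    simp only [inTangentCoordinates, ContinuousLinearMap.inCoordinates]
    simp
    exact congrArg (α (φ x)) (key _).symm

/-- The bracket `{f, g} = π(df, dg) = ⟨dg, (df)^#⟩` of two functions, for a bivector field `π`
given by its bundle map `α ↦ α^#`. -/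
def bivectorBracket (sharp : ∀ x : M, CotangentSpace F M x →L[ℝ] TangentSpace 𝓘(ℝ, F) x)
    (f g : M → ℝ) : M → ℝ :=
  fun x => dAt g x (sharp x (dAt f x))

variable (F M) in
/-- A Poisson bivector field `π` on `M`, encoded by its smooth bundle map
`T^*M → TM, α ↦ α^#`, where `⟨β, α^#⟩ = π(α, β)`. The condition `[π, π] = 0` is
the Jacobi identity for the bracket `{f, g} = π(df, dg)` of smooth functions. -/
structure PoissonTensor where
  sharp : ∀ x : M, CotangentSpace F M x →L[ℝ] TangentSpace 𝓘(ℝ, F) x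
  contMDiff_sharp : ContMDiff 𝓘(ℝ, F) (𝓘(ℝ, F).prod 𝓘(ℝ, (F →L[ℝ] ℝ) →L[ℝ] F)) ∞
    (fun x => Bundle.TotalSpace.mk' ((F →L[ℝ] ℝ) →L[ℝ] F)
      (E := fun x : M => CotangentSpace F M x →L[ℝ] TangentSpace 𝓘(ℝ, F) x) x (sharp x))
  skew : ∀ (x : M) (α β : CotangentSpace F M x), β (sharp x α) = -α (sharp x β)
  jacobi : ∀ f g h : C^∞⟮𝓘(ℝ, F), M; ℝ⟯,
    bivectorBracket sharp f (bivectorBracket sharp g h) +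
      bivectorBracket sharp g (bivectorBracket sharp h f) +
      bivectorBracket sharp h (bivectorBracket sharp f g) = 0

/-- A contravariant connection `D` on the Poisson manifold `(M, π)`: an `ℝ`-bilinear map on
one-forms with `D_{fα} β = f D_α β` and `D_α (fβ) = (α^# · f) β + f D_α β`. -/
structure ContravariantConnection (P : PoissonTensor F M) where
  toFun : OneForm F M →ₗ[ℝ] OneForm F M →ₗ[ℝ] OneForm F M
  smul_left : ∀ (f : C^∞⟮𝓘(ℝ, F), M; ℝ⟯) (α β : OneForm F M),
    toFun (OneForm.smul f α) β = OneForm.smul f (toFun α β)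
  leibniz : ∀ (f : C^∞⟮𝓘(ℝ, F), M; ℝ⟯) (α β : OneForm F M) (x : M),
    toFun α (OneForm.smul f β) x =
      dAt f x (P.sharp x (α x)) • β x + f x • toFun α β x

end Manifold

section Homogeneous

variable (E F : Type*) [NormedAddCommGroup E] [NormedSpace ℝ E]
  [NormedAddCommGroup F] [NormedSpace ℝ F] [FiniteDimensional ℝ F]
  {G : Type*} [TopologicalSpace G] [Group G] [ChartedSpace E G] [LieGroup 𝓘(ℝ, E) ∞ G]
  (H : Subgroup G) [ChartedSpace F (G ⧸ H)] [IsManifold 𝓘(ℝ, F) ∞ (G ⧸ H)]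

/-- The smooth structure on the topological quotient `G ⧸ H` is the quotient one, i.e. the
(unique) one for which `p : G → G ⧸ H` is a smooth submersion. -/
class IsQuotientManifold : Prop where
  contMDiff_mk : ContMDiff 𝓘(ℝ, E) 𝓘(ℝ, F) ∞ (QuotientGroup.mk : G → G ⧸ H)
  surjective_mfderiv_mk : ∀ g : G, Function.Surjective
    (mfderiv 𝓘(ℝ, E) 𝓘(ℝ, F) (QuotientGroup.mk : G → G ⧸ H) g)

/-- The translations of `G ⧸ H` are smooth. -/
theorem contMDiff_smul_left [IsQuotientManifold E F H] (g : G) :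
    ContMDiff 𝓘(ℝ, F) 𝓘(ℝ, F) ∞ (fun x : G ⧸ H => g • x) := by
  intro x
  obtain ⟨k, rfl⟩ := QuotientGroup.mk_surjective x
  obtain ⟨σ, h1, h2, h3⟩ := exists_contMDiffAt_localSection
    ((IsQuotientManifold.contMDiff_mk (E := E) (F := F) (H := H)) k)
    (IsQuotientManifold.surjective_mfderiv_mk (E := E) (F := F) (H := H) k)
  have hp := IsQuotientManifold.contMDiff_mk (E := E) (F := F) (H := H)
  have h4 : ContMDiffAt 𝓘(ℝ, F) 𝓘(ℝ, F) ∞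
      (fun y : G ⧸ H => (QuotientGroup.mk (g * σ y) : G ⧸ H)) (k : G ⧸ H) :=
    (hp _).comp _ ((contMDiff_mul_left (I := 𝓘(ℝ, E)) (n := ∞) (a := g) _).comp _ h1)
  refine h4.congr_of_eventuallyEq ?_
  filter_upwards [h3] with y hy
  conv_lhs => rw [← hy]
  rfl

/-- The translation `λ_g : G ⧸ H → G ⧸ H` as a smooth map. -/
def translation [IsQuotientManifold E F H] (g : G) : C^∞⟮𝓘(ℝ, F), G ⧸ H; 𝓘(ℝ, F), G ⧸ H⟯ :=
  ⟨fun x => g • x, contMDiff_smul_left E F H g⟩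


/-- The action `g • α = λ_{g⁻¹}^* α` of `G` on one-forms. -/
def act [IsQuotientManifold E F H] (g : G) (α : OneForm F (G ⧸ H)) : OneForm F (G ⧸ H) :=
  OneForm.pullback (translation E F H g⁻¹) α

variable {F H} in
/-- `G`-invariance of `π`: `π_{#, g x} = T_x λ_g ∘ π_{#, x} ∘ (T_x λ_g)^*`. -/
def PoissonTensor.IsInvariant (P : PoissonTensor F (G ⧸ H)) : Prop :=
  ∀ (g : G) (x : G ⧸ H) (α : CotangentSpace F (G ⧸ H) (g • x)),
    P.sharp (g • x) α =
      mfderiv 𝓘(ℝ, F) 𝓘(ℝ, F) (fun y : G ⧸ H => g • y) x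
        (P.sharp x (α.comp (mfderiv 𝓘(ℝ, F) 𝓘(ℝ, F) (fun y : G ⧸ H => g • y) x)))

variable {F H} in
/-- `G`-invariance of `D`: `g • D_α β = D_{g • α} (g • β)`. -/
def ContravariantConnection.IsInvariant [IsQuotientManifold E F H]
    {P : PoissonTensor F (G ⧸ H)} (D : ContravariantConnection P) : Prop :=
  ∀ (g : G) (α β : OneForm F (G ⧸ H)),
    act E F H g (D.toFun α β) = D.toFun (act E F H g α) (act E F H g β)

/-- The adjoint representation: `Ad g` is the derivative at `1` of `x ↦ g x g⁻¹`. -/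
def Ad (g : G) : GroupLieAlgebra 𝓘(ℝ, E) G →L[ℝ] GroupLieAlgebra 𝓘(ℝ, E) G :=
  mfderiv 𝓘(ℝ, E) 𝓘(ℝ, E) (fun x : G => g * x * g⁻¹) 1

/-- The velocity at `1` of a product of curves is the sum of the velocities. -/
theorem mfderiv_mul_curve {γ δ : ℝ → G} {u v : GroupLieAlgebra 𝓘(ℝ, E) G}
    (hγ : MDifferentiableAt 𝓘(ℝ, ℝ) 𝓘(ℝ, E) γ 0) (hδ : MDifferentiableAt 𝓘(ℝ, ℝ) 𝓘(ℝ, E) δ 0)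
    (hγ1 : γ 0 = 1) (hδ1 : δ 0 = 1)
    (hu : mfderiv 𝓘(ℝ, ℝ) 𝓘(ℝ, E) γ 0 (1 : ℝ) = u) (hv : mfderiv 𝓘(ℝ, ℝ) 𝓘(ℝ, E) δ 0 (1 : ℝ) = v) :
    mfderiv 𝓘(ℝ, ℝ) 𝓘(ℝ, E) (fun t => γ t * δ t) 0 (1 : ℝ) = (u + v : E) := by
  have hmul : MDifferentiableAt (𝓘(ℝ, E).prod 𝓘(ℝ, E)) 𝓘(ℝ, E) (fun z : G × G => z.1 * z.2)
      (γ 0, δ 0) := (contMDiff_mul 𝓘(ℝ, E) ∞).mdifferentiableAt (by simp)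
  have h1 := mfderiv_comp (I := 𝓘(ℝ, ℝ)) (0 : ℝ) (g := fun z : G × G => z.1 * z.2)
    (f := fun t => (γ t, δ t)) hmul (hγ.prodMk hδ)
  have h2 : (fun t => γ t * δ t) = (fun z : G × G => z.1 * z.2) ∘ (fun t => (γ t, δ t)) := rfl
  rw [h2, h1]
  rw [hγ.mfderiv_prod hδ]
  erw [ContinuousLinearMap.comp_apply, mfderiv_prod_eq_add_apply hmul]
  have e1 : @Eq (E →L[ℝ] E) (mfderiv 𝓘(ℝ, E) 𝓘(ℝ, E) (fun z : G => z * δ 0) (γ 0))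
      (ContinuousLinearMap.id ℝ E) :=
    (mfderiv_congr (by ext z; simp [hδ1])).trans mfderiv_id
  have e2 : @Eq (E →L[ℝ] E) (mfderiv 𝓘(ℝ, E) 𝓘(ℝ, E) (fun z : G => γ 0 * z) (δ 0))
      (ContinuousLinearMap.id ℝ E) :=
    (mfderiv_congr (by ext z; simp [hγ1])).trans mfderiv_id
  refine congrArg₂ (fun a b : E => a + b) (?_ : _ = (u : E)) (?_ : _ = (v : E))
  · exact (DFunLike.congr_fun e1 _).trans hu
  · exact (DFunLike.congr_fun e2 _).trans hv

variable {E} in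
/-- The Lie algebra `𝔥 ⊆ 𝔤` of the subgroup `H`: the velocities at `0` of the (germs of) smooth
curves in `G` which stay in `H` and pass through `1` at time `0`. -/
def lieSubalgebra : Submodule ℝ (GroupLieAlgebra 𝓘(ℝ, E) G) where
  carrier := {u | ∃ γ : ℝ → G, ContMDiffAt 𝓘(ℝ, ℝ) 𝓘(ℝ, E) ∞ γ 0 ∧ γ 0 = 1 ∧
    (∀ᶠ t in 𝓝 0, γ t ∈ H) ∧ mfderiv 𝓘(ℝ, ℝ) 𝓘(ℝ, E) γ 0 (1 : ℝ) = u}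
  zero_mem' := by
    refine ⟨fun _ => 1, contMDiffAt_const, rfl, Filter.Eventually.of_forall fun _ => H.one_mem, ?_⟩
    rw [mfderiv_const]
    rfl
  add_mem' := by
    rintro u v ⟨γ, h1, h2, h3, h4⟩ ⟨δ, k1, k2, k3, k4⟩
    refine ⟨fun t => γ t * δ t, h1.mul k1, by simp [h2, k2], ?_, ?_⟩
    · filter_upwards [h3, k3] with t ht kt using H.mul_mem ht kt
    · exact mfderiv_mul_curve E (h1.mdifferentiableAt (by simp)) (k1.mdifferentiableAt (by simp))
        h2 k2 h4 k4
  smul_mem' := by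
    rintro c u ⟨γ, h1, h2, h3, h4⟩
    have hc : HasFDerivAt (fun t : ℝ => c * t) (c • ContinuousLinearMap.id ℝ ℝ) 0 := by
      simpa using (hasFDerivAt_id (𝕜 := ℝ) (0 : ℝ)).const_mul c
    have h1' : ContMDiffAt 𝓘(ℝ, ℝ) 𝓘(ℝ, E) ∞ γ (c * 0) := by simpa using h1
    have hcs : ContMDiffAt 𝓘(ℝ, ℝ) 𝓘(ℝ, ℝ) ∞ (fun t : ℝ => c * t) 0 := by
      have : ContDiff ℝ ∞ (fun t : ℝ => c * t) := by fun_prop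
      exact this.contMDiff _
    refine ⟨fun t => γ (c * t), ContMDiffAt.comp (0 : ℝ) h1' hcs, by simp [h2], ?_, ?_⟩
    · have : ContinuousAt (fun t : ℝ => c * t) 0 := by fun_prop
      have h := this.eventually (p := fun s => γ s ∈ H) (by simpa using h3)
      exact h
    · have hd := HasMFDerivAt.comp (0 : ℝ) (h1'.mdifferentiableAt (by simp)).hasMFDerivAt
        hc.hasMFDerivAt
      have e : @Eq (ℝ →L[ℝ] E) (mfderiv 𝓘(ℝ, ℝ) 𝓘(ℝ, E) γ (c * 0))
          (mfderiv 𝓘(ℝ, ℝ) 𝓘(ℝ, E) γ 0) := mfderiv_congr_point (by simp)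
      have h5 : mfderiv 𝓘(ℝ, ℝ) 𝓘(ℝ, E) (fun t => γ (c * t)) 0 = _ := hd.mfderiv
      rw [h5]
      obtain ⟨L, hL⟩ : ∃ L : ℝ →L[ℝ] E, L = mfderiv 𝓘(ℝ, ℝ) 𝓘(ℝ, E) γ 0 := ⟨_, rfl⟩
      have h6 : L (c • (1 : ℝ)) = c • (u : E) := by
        rw [map_smul, hL]
        exact congrArg (fun z : E => c • z) h4
      refine Eq.trans ?_ h6
      rw [hL]
      exact DFunLike.congr_fun e _

/-- `𝔥` is the kernel of `T_1 p : 𝔤 → T_ē(G ⧸ H)`. -/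
theorem mem_lieSubalgebra_iff [IsQuotientManifold E F H] (u : GroupLieAlgebra 𝓘(ℝ, E) G) :
    u ∈ lieSubalgebra H ↔
      mfderiv 𝓘(ℝ, E) 𝓘(ℝ, F) (QuotientGroup.mk : G → G ⧸ H) 1 u = 0 := by
  have hp := IsQuotientManifold.contMDiff_mk (E := E) (F := F) (H := H)
  constructor
  · rintro ⟨γ, h1, h2, h3, h4⟩
    have hp' : MDifferentiableAt 𝓘(ℝ, E) 𝓘(ℝ, F) (QuotientGroup.mk : G → G ⧸ H) (γ 0) :=
      (hp _).mdifferentiableAt (by simp)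
    have hc := mfderiv_comp (0 : ℝ) hp' (h1.mdifferentiableAt (by simp))
    have hconst : ((QuotientGroup.mk : G → G ⧸ H) ∘ γ) =ᶠ[𝓝 0] fun _ => ((1 : G) : G ⧸ H) := by
      filter_upwards [h3] with t ht
      exact (QuotientGroup.eq.2 (by simpa using ht))
    have h5 : @Eq (ℝ →L[ℝ] F) (mfderiv 𝓘(ℝ, ℝ) 𝓘(ℝ, F) ((QuotientGroup.mk : G → G ⧸ H) ∘ γ) 0) 0 :=
      hconst.mfderiv_eq.trans mfderiv_const
    have h6 := (DFunLike.congr_fun hc (1 : ℝ)).symm.trans (DFunLike.congr_fun h5 (1 : ℝ))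
    have e : @Eq (E →L[ℝ] F) (mfderiv 𝓘(ℝ, E) 𝓘(ℝ, F) (QuotientGroup.mk : G → G ⧸ H) (γ 0))
        (mfderiv 𝓘(ℝ, E) 𝓘(ℝ, F) (QuotientGroup.mk : G → G ⧸ H) 1) := mfderiv_congr_point h2
    have h7 : (mfderiv 𝓘(ℝ, E) 𝓘(ℝ, F) (QuotientGroup.mk : G → G ⧸ H) (γ 0) : E →L[ℝ] F) u = 0 := by
      rw [← h4]; exact h6
    rw [e] at h7
    exact h7
  · intro hu
    obtain ⟨σ, s1, s2, s3⟩ := exists_contMDiffAt_localSection (hp 1)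
      (IsQuotientManifold.surjective_mfderiv_mk (E := E) (F := F) (H := H) 1)
    have hinv := isInvertible_mfderivWithin_extChartAt_symm (I := 𝓘(ℝ, E))
      (mem_extChartAt_target (I := 𝓘(ℝ, E)) (1 : G))
    have hrange : Set.range 𝓘(ℝ, E) = Set.univ := by simp
    rw [hrange, mfderivWithin_univ] at hinv
    obtain ⟨a, ha⟩ : ∃ a : E, a = extChartAt 𝓘(ℝ, E) (1 : G) 1 := ⟨_, rfl⟩
    rw [← ha] at hinv
    obtain ⟨w, hw⟩ : ∃ w : E, mfderiv 𝓘(ℝ, E) 𝓘(ℝ, E) (extChartAt 𝓘(ℝ, E) (1 : G)).symm a w = u :=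
      hinv.bijective.2 u
    have hl : HasFDerivAt (fun t : ℝ => a + t • w)
        ((ContinuousLinearMap.id ℝ ℝ).smulRight w) 0 :=
      ((hasFDerivAt_id (𝕜 := ℝ) (0 : ℝ)).smul_const w).const_add a
    have hls : ContMDiffAt 𝓘(ℝ, ℝ) 𝓘(ℝ, E) ∞ (fun t : ℝ => a + t • w) 0 := by
      have : ContDiff ℝ ∞ (fun t : ℝ => a + t • w) := by fun_prop
      exact this.contMDiff _
    have hsy : ContMDiffAt 𝓘(ℝ, E) 𝓘(ℝ, E) ∞ (extChartAt 𝓘(ℝ, E) (1 : G)).symm a := by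
      rw [ha]
      exact (contMDiffOn_extChartAt_symm (1 : G)).contMDiffAt (extChartAt_target_mem_nhds (1 : G))
    have hsy' : ContMDiffAt 𝓘(ℝ, E) 𝓘(ℝ, E) ∞ (extChartAt 𝓘(ℝ, E) (1 : G)).symm
        (a + (0 : ℝ) • w) := by simpa using hsy
    obtain ⟨c, hc⟩ : ∃ c : ℝ → G, c = fun t => (extChartAt 𝓘(ℝ, E) (1 : G)).symm (a + t • w) :=
      ⟨_, rfl⟩
    have hcs : ContMDiffAt 𝓘(ℝ, ℝ) 𝓘(ℝ, E) ∞ c 0 := by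
      rw [hc]; exact ContMDiffAt.comp (0 : ℝ) hsy' hls
    have hc0 : c 0 = 1 := by simp [hc, ha]
    have hcu : mfderiv 𝓘(ℝ, ℝ) 𝓘(ℝ, E) c 0 (1 : ℝ) = u := by
      have hd := (HasMFDerivAt.comp (0 : ℝ) (hsy'.mdifferentiableAt (by simp)).hasMFDerivAt
        hl.hasMFDerivAt).mfderiv
      have hd' : @Eq (ℝ →L[ℝ] E) (mfderiv 𝓘(ℝ, ℝ) 𝓘(ℝ, E) c 0)
          (mfderiv 𝓘(ℝ, ℝ) 𝓘(ℝ, E)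
            ((extChartAt 𝓘(ℝ, E) (1 : G)).symm ∘ fun t : ℝ => a + t • w) 0) := mfderiv_congr hc
      have e : @Eq (E →L[ℝ] E)
          (mfderiv 𝓘(ℝ, E) 𝓘(ℝ, E) (extChartAt 𝓘(ℝ, E) (1 : G)).symm (a + (0 : ℝ) • w))
          (mfderiv 𝓘(ℝ, E) 𝓘(ℝ, E) (extChartAt 𝓘(ℝ, E) (1 : G)).symm a) :=
        mfderiv_congr_point (by simp)
      refine (DFunLike.congr_fun (hd'.trans hd) (1 : ℝ)).trans ?_
      refine (DFunLike.congr_fun e _).trans ?_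
      refine Eq.trans ?_ hw
      have h1 : ((ContinuousLinearMap.id ℝ ℝ).smulRight w) (1 : ℝ) = w := by simp
      exact congrArg (mfderiv 𝓘(ℝ, E) 𝓘(ℝ, E) (extChartAt 𝓘(ℝ, E) (1 : G)).symm a) h1
    -- correct `c` by the local section, so as to stay in `H`
    obtain ⟨κ, hκ⟩ : ∃ κ : G → G, κ = fun x : G => (σ (QuotientGroup.mk x))⁻¹ := ⟨_, rfl⟩
    have hκs : ContMDiffAt 𝓘(ℝ, E) 𝓘(ℝ, E) ∞ κ (c 0) := by
      have : ContMDiffAt 𝓘(ℝ, E) 𝓘(ℝ, E) ∞ κ 1 := by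
        rw [hκ]; exact (ContMDiffAt.comp (1 : G) s1 (hp 1)).inv
      rwa [hc0]
    have hκd : mfderiv 𝓘(ℝ, E) 𝓘(ℝ, E) κ (1 : G) u = 0 := by
      have hs' : MDifferentiableAt 𝓘(ℝ, F) 𝓘(ℝ, E) (fun x => (σ x)⁻¹) ((1 : G) : G ⧸ H) :=
        s1.inv.mdifferentiableAt (by simp)
      have hd := mfderiv_comp (1 : G) hs' ((hp 1).mdifferentiableAt (by simp))
      have hd' : @Eq (E →L[ℝ] E) (mfderiv 𝓘(ℝ, E) 𝓘(ℝ, E) κ 1)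
          (mfderiv 𝓘(ℝ, E) 𝓘(ℝ, E)
            ((fun x : G ⧸ H => (σ x)⁻¹) ∘ (QuotientGroup.mk : G → G ⧸ H)) 1) := mfderiv_congr hκ
      refine (DFunLike.congr_fun (hd'.trans hd) u).trans ?_
      exact (congrArg (mfderiv 𝓘(ℝ, F) 𝓘(ℝ, E) (fun x => (σ x)⁻¹) ((1 : G) : G ⧸ H)) hu).trans
        (map_zero _)
    have hκc : mfderiv 𝓘(ℝ, ℝ) 𝓘(ℝ, E) (fun t => κ (c t)) 0 (1 : ℝ) = (0 : E) := by
      have hd := mfderiv_comp (0 : ℝ) (hκs.mdifferentiableAt (by simp))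
        (hcs.mdifferentiableAt (by simp))
      have e : @Eq (E →L[ℝ] E) (mfderiv 𝓘(ℝ, E) 𝓘(ℝ, E) κ (c 0))
          (mfderiv 𝓘(ℝ, E) 𝓘(ℝ, E) κ 1) := mfderiv_congr_point hc0
      refine (DFunLike.congr_fun hd (1 : ℝ)).trans ?_
      refine (DFunLike.congr_fun e _).trans ?_
      exact (congrArg (mfderiv 𝓘(ℝ, E) 𝓘(ℝ, E) κ (1 : G)) hcu).trans hκd
    have hκ1 : κ 1 = 1 := by rw [hκ]; simp [s2]
    have hκcs : ContMDiffAt 𝓘(ℝ, ℝ) 𝓘(ℝ, E) ∞ (fun t => κ (c t)) 0 :=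
      ContMDiffAt.comp (0 : ℝ) hκs hcs
    refine ⟨fun t => κ (c t) * c t, hκcs.mul hcs, by simp [hc0, hκ1], ?_, ?_⟩
    · have hcont : ContinuousAt (fun t => (QuotientGroup.mk (c t) : G ⧸ H)) 0 :=
        ContinuousAt.comp (g := (QuotientGroup.mk : G → G ⧸ H)) hp.continuous.continuousAt
          hcs.continuousAt
      have s3' : ∀ᶠ y in 𝓝 ((QuotientGroup.mk (c 0) : G ⧸ H)),
          (QuotientGroup.mk (σ y) : G ⧸ H) = y := by rw [hc0]; exact s3
      filter_upwards [hcont.eventually s3'] with t ht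
      rw [hκ]
      exact QuotientGroup.eq.1 ht
    · have := mfderiv_mul_curve E (u := 0) (v := u) (hκcs.mdifferentiableAt (by simp))
        (hcs.mdifferentiableAt (by simp)) (by simp [hc0, hκ1]) hc0 hκc hcu
      exact this.trans (zero_add (u : E))

variable {E} in
/-- `𝔪` is a reductive complement: `𝔤 = 𝔥 ⊕ 𝔪` and `Ad_a(𝔪) = 𝔪` for all `a ∈ H`. -/
structure IsReductiveComplement (𝔪 : Submodule ℝ (GroupLieAlgebra 𝓘(ℝ, E) G)) : Prop where
  isCompl : IsCompl (lieSubalgebra H) 𝔪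
  map_Ad : ∀ a ∈ H, 𝔪.map (Ad E a).toLinearMap = 𝔪

variable {E H} in
/-- The contragredient map `Ad_a^* : 𝔪^* → 𝔪^*`, `(Ad_a^* η)(u) = η(Ad_a u)`, for `a ∈ H`. -/
def coAd {𝔪 : Submodule ℝ (GroupLieAlgebra 𝓘(ℝ, E) G)} (h : IsReductiveComplement H 𝔪) (a : H) :
    Module.Dual ℝ 𝔪 →ₗ[ℝ] Module.Dual ℝ 𝔪 :=
  Module.Dual.transpose
    ((Ad E (a : G)).toLinearMap.restrict (p := 𝔪) (q := 𝔪) fun _ hu => (h.map_Ad a a.2).le (Submodule.mem_map_of_mem hu))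

variable {E H} in
/-- `Ad(H)`-invariance of a bilinear map `𝔟 : 𝔪^* × 𝔪^* → 𝔪^*`. -/
def IsAdInvariant {𝔪 : Submodule ℝ (GroupLieAlgebra 𝓘(ℝ, E) G)} (h : IsReductiveComplement H 𝔪)
    (b : Module.Dual ℝ 𝔪 →ₗ[ℝ] Module.Dual ℝ 𝔪 →ₗ[ℝ] Module.Dual ℝ 𝔪) : Prop :=
  ∀ (a : H) (η ξ : Module.Dual ℝ 𝔪), coAd h a (b η ξ) = b (coAd h a η) (coAd h a ξ)

variable {E} in
/-- The fundamental vector field `u^*` on `G ⧸ H`, whose value at `x` is the velocity at `t = 0`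
of `exp(-t u) • x`, i.e. the image of `-u` under the derivative of the orbit map `g ↦ g • x`. -/
def fundamentalField (u : GroupLieAlgebra 𝓘(ℝ, E) G) (x : G ⧸ H) : TangentSpace 𝓘(ℝ, F) x :=
  (mfderiv 𝓘(ℝ, E) 𝓘(ℝ, F) (fun g : G => g • x) 1 : E →L[ℝ] F) (-u : E)

theorem fundamentalField_base (u : GroupLieAlgebra 𝓘(ℝ, E) G) :
    fundamentalField F H u ((1 : G) : G ⧸ H) =
      -mfderiv 𝓘(ℝ, E) 𝓘(ℝ, F) (QuotientGroup.mk : G → G ⧸ H) 1 u := by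
  have e : @Eq (E →L[ℝ] F)
      (mfderiv 𝓘(ℝ, E) 𝓘(ℝ, F) (fun g : G => g • ((1 : G) : G ⧸ H)) 1)
      (mfderiv 𝓘(ℝ, E) 𝓘(ℝ, F) (QuotientGroup.mk : G → G ⧸ H) 1) :=
    mfderiv_congr (by ext g; exact congrArg QuotientGroup.mk (mul_one g))
  refine (DFunLike.congr_fun e _).trans ?_
  exact map_neg (mfderiv 𝓘(ℝ, E) 𝓘(ℝ, F) (QuotientGroup.mk : G → G ⧸ H) 1) u

section Base

variable {E F H}
variable [IsQuotientManifold E F H] {𝔪 : Submodule ℝ (GroupLieAlgebra 𝓘(ℝ, E) G)}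

variable (F H) in
/-- The linear map `𝔤 → T_ē(G ⧸ H)`, `u ↦ u^*_ē`. -/
def baseFundamental :
    GroupLieAlgebra 𝓘(ℝ, E) G →ₗ[ℝ] TangentSpace 𝓘(ℝ, F) ((1 : G) : G ⧸ H) where
  toFun u := fundamentalField F H u ((1 : G) : G ⧸ H)
  map_add' u v := by
    rw [fundamentalField_base, fundamentalField_base, fundamentalField_base, map_add, neg_add]
  map_smul' c u := by
    rw [fundamentalField_base, fundamentalField_base, map_smul, smul_neg, RingHom.id_apply]

theorem baseFundamental_apply (u : GroupLieAlgebra 𝓘(ℝ, E) G) :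
    baseFundamental F H u =
      -mfderiv 𝓘(ℝ, E) 𝓘(ℝ, F) (QuotientGroup.mk : G → G ⧸ H) 1 u :=
  fundamentalField_base E F H u

/-- The identification `𝔪 ≃ T_ē(G ⧸ H)`, `u ↦ u^*_ē`. -/
def baseTangentEquiv (h : IsReductiveComplement H 𝔪) :
    𝔪 ≃ₗ[ℝ] TangentSpace 𝓘(ℝ, F) ((1 : G) : G ⧸ H) :=
  LinearEquiv.ofBijective ((baseFundamental F H).domRestrict 𝔪)
    ⟨by
      rw [← LinearMap.ker_eq_bot, LinearMap.ker_eq_bot']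
      intro u hu
      have h1 : baseFundamental F H (u : GroupLieAlgebra 𝓘(ℝ, E) G) = 0 := hu
      rw [baseFundamental_apply, neg_eq_zero, ← mem_lieSubalgebra_iff] at h1
      exact Subtype.ext ((Submodule.disjoint_def.1 h.isCompl.disjoint) _ h1 u.2),
    fun x => by
      obtain ⟨w, hw⟩ := IsQuotientManifold.surjective_mfderiv_mk (E := E) (F := F) (H := H) 1 (-x)
      obtain ⟨k, hk, m, hm, hkm⟩ := Submodule.mem_sup.1
        (h.isCompl.sup_eq_top.ge (Submodule.mem_top : w ∈ ⊤))
      refine ⟨⟨m, hm⟩, (baseFundamental_apply (F := F) (H := H) m).trans ?_⟩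
      have h1 := (mem_lieSubalgebra_iff E F H k).1 hk
      rw [← hkm, map_add, h1, zero_add] at hw
      exact (congrArg (fun z : F => -z) hw).trans (neg_neg (x : F))⟩

/-- The dual identification `T_ē^*(G ⧸ H) → 𝔪^*`, `α ↦ (u ↦ α(u^*_ē))`. -/
def baseCotangent (h : IsReductiveComplement H 𝔪) :
    CotangentSpace F (G ⧸ H) ((1 : G) : G ⧸ H) →ₗ[ℝ] Module.Dual ℝ 𝔪 where
  toFun α := (α : TangentSpace 𝓘(ℝ, F) ((1 : G) : G ⧸ H) →ₗ[ℝ] ℝ) ∘ₗ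
    (baseTangentEquiv (F := F) h).toLinearMap
  map_add' _ _ := rfl
  map_smul' _ _ := rfl

/-- The function `F^β : G → 𝔪^*`, `F^β(g) = (g⁻¹ • β)_ē`. -/
def formFunction (h : IsReductiveComplement H 𝔪) (β : OneForm F (G ⧸ H)) (g : G) :
    Module.Dual ℝ 𝔪 :=
  baseCotangent h (act E F H g⁻¹ β ((1 : G) : G ⧸ H))

/-- For `u ∈ 𝔪` and `f : G → 𝔪^*`, the value at `v ∈ 𝔪` of `u · f = (df)_1(-u) ∈ 𝔪^*`. Since `𝔪^*`
is finite-dimensional, the derivative is computed on the components `g ↦ f(g)(v)`. -/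
def dualDeriv (u : 𝔪) (f : G → Module.Dual ℝ 𝔪) (v : 𝔪) : ℝ :=
  (mfderiv 𝓘(ℝ, E) 𝓘(ℝ, ℝ) (fun g : G => f g v) 1 : GroupLieAlgebra 𝓘(ℝ, E) G →L[ℝ] ℝ) (-u)

end Base

end Homogeneous

end PoissonHomogeneous

end

open PoissonHomogeneous

/-! A one-form `β` on `G ⧸ H` carries the same information as its function `F^β : G → 𝔪^*`, and the
functions that occur are exactly the smooth ones with `F(ga) = Ad_a^* F(g)` for `a ∈ H`
(`formFunction_mul_mem`, `formFunction_injective`, `exists_formFunction_eq`). Under this dictionary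
the action of `G` on one-forms becomes left translation of the argument, so an invariant connection
is determined by its values at `ē`.

Translated to an arbitrary `g`, the required formula reads `F^{D_α β}(g) = 𝔟(F^α(g), F^β(g)) +
S(g)`. Here `S = sharpDeriv` differentiates `F^β` at `g` along the left-invariant field of `-u`,
where `u ∈ 𝔪` corresponds to `F^α(g)` under `#` at `ē`. Invariance of `π` makes `S` equivariant
under `H` (`sharpDeriv_mul_mem`) and identifies the direction of differentiation with `α^#` at `gH`.
Hence `S` satisfies both axioms of a contravariant connection (`sharpDeriv_smul_left`,
`sharpDeriv_smul_right`).

Given `D`, the difference `D - S` at `ē` is therefore tensorial in both arguments, and a tensorial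
map sees only the values of the forms at `ē`; this yields `𝔟` (`exists_hasBilin`). Comparing the
formula at `g = 1` and at `g = a ∈ H` shows that `𝔟` is `Ad(H)`-invariant. Given an invariant `𝔟`,
the right-hand side is smooth and equivariant, so it is the function of a one-form, and that
one-form is taken as `D_α β` (`exists_connection_of_isAdInvariant`). -/

noncomputable section

set_option linter.unusedSectionVars false

namespace PoissonHomogeneous

/-! ### Smooth families of tangent vectors and covectors -/

section TangentMaps

variable {E₁ E₂ E₃ : Type*} [NormedAddCommGroup E₁] [NormedSpace ℝ E₁]
  [NormedAddCommGroup E₂] [NormedSpace ℝ E₂] [NormedAddCommGroup E₃] [NormedSpace ℝ E₃]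
  {N M M' : Type*} [TopologicalSpace N] [ChartedSpace E₁ N] [IsManifold 𝓘(ℝ, E₁) ∞ N]
  [TopologicalSpace M] [ChartedSpace E₂ M] [IsManifold 𝓘(ℝ, E₂) ∞ M]
  [TopologicalSpace M'] [ChartedSpace E₃ M'] [IsManifold 𝓘(ℝ, E₃) ∞ M']

/-- Smoothness of `n ↦ T_{g(n)}(f n) (v n)` for a smooth family `f` of maps and a smooth family `v`
of tangent vectors along `g`. -/
theorem contMDiffAt_mfderiv_apply_section {f : N → M → M'} {g : N → M} {n₀ : N}
    {v : ∀ n, TangentSpace 𝓘(ℝ, E₂) (g n)}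
    (hf : ContMDiffAt (𝓘(ℝ, E₁).prod 𝓘(ℝ, E₂)) 𝓘(ℝ, E₃) ∞ (Function.uncurry f) (n₀, g n₀))
    (hg : ContMDiffAt 𝓘(ℝ, E₁) 𝓘(ℝ, E₂) ∞ g n₀)
    (hv : ContMDiffAt 𝓘(ℝ, E₁) (𝓘(ℝ, E₂).prod 𝓘(ℝ, E₂)) ∞
      (fun n => (⟨g n, v n⟩ : TangentBundle 𝓘(ℝ, E₂) M)) n₀) :
    ContMDiffAt 𝓘(ℝ, E₁) (𝓘(ℝ, E₃).prod 𝓘(ℝ, E₃)) ∞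
      (fun n => (⟨f n (g n), mfderiv 𝓘(ℝ, E₂) 𝓘(ℝ, E₃) (f n) (g n) (v n)⟩ :
        TangentBundle 𝓘(ℝ, E₃) M')) n₀ := by
  have h1 := ContMDiffAt.mfderiv (m := ∞) (n := ∞) f g hf hg (by simp)
  refine ContMDiffAt.clm_apply_of_inCoordinates (b₁ := g) (b₂ := fun n => f n (g n))
    (ϕ := fun n => mfderiv 𝓘(ℝ, E₂) 𝓘(ℝ, E₃) (f n) (g n)) h1 hv ?_
  exact ContMDiffAt.comp (g := Function.uncurry f) (f := fun n => (n, g n)) n₀ hf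
    (contMDiffAt_id.prodMk hg)

/-- The pairing of a smooth one-form with a smooth family of tangent vectors is smooth. -/
theorem contMDiffAt_oneForm_apply {α : OneForm E₂ M} {g : N → M} {n₀ : N}
    {v : ∀ n, TangentSpace 𝓘(ℝ, E₂) (g n)}
    (hv : ContMDiffAt 𝓘(ℝ, E₁) (𝓘(ℝ, E₂).prod 𝓘(ℝ, E₂)) ∞
      (fun n => (⟨g n, v n⟩ : TangentBundle 𝓘(ℝ, E₂) M)) n₀) :
    ContMDiffAt 𝓘(ℝ, E₁) 𝓘(ℝ, ℝ) ∞ (fun n => α (g n) (v n)) n₀ := by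
  have hg : ContMDiffAt 𝓘(ℝ, E₁) 𝓘(ℝ, E₂) ∞ g n₀ := (Bundle.contMDiffAt_totalSpace.1 hv).1
  have h1 := ContMDiffAt.comp n₀ (α.contMDiff (g n₀)) hg
  have h2 := ContMDiffAt.clm_bundle_apply (b := g) (ϕ := fun n => α (g n)) (v := v)
    (E₂ := Bundle.Trivial M ℝ) h1 hv
  exact (Bundle.contMDiffAt_totalSpace.1 h2).2

/-- A section of the cotangent bundle is smooth as soon as its pairings with smooth local vector
fields are. -/
theorem contMDiffAt_cotangent_of_apply [FiniteDimensional ℝ E₂]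
    {s : ∀ x : M, CotangentSpace E₂ M x} {x₀ : M}
    (hs : ∀ v : ∀ x : M, TangentSpace 𝓘(ℝ, E₂) x,
      ContMDiffAt 𝓘(ℝ, E₂) (𝓘(ℝ, E₂).prod 𝓘(ℝ, E₂)) ∞
        (fun x => (⟨x, v x⟩ : TangentBundle 𝓘(ℝ, E₂) M)) x₀ →
      ContMDiffAt 𝓘(ℝ, E₂) 𝓘(ℝ, ℝ) ∞ (fun x => s x (v x)) x₀) :
    ContMDiffAt 𝓘(ℝ, E₂) (𝓘(ℝ, E₂).prod 𝓘(ℝ, E₂ →L[ℝ] ℝ)) ∞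
      (fun x => Bundle.TotalSpace.mk' (E₂ →L[ℝ] ℝ) (E := fun x : M => CotangentSpace E₂ M x)
        x (s x)) x₀ := by
  let t := trivializationAt E₂ (TangentSpace 𝓘(ℝ, E₂)) x₀
  have ht : x₀ ∈ t.baseSet := FiberBundle.mem_baseSet_trivializationAt' x₀
  let b := Module.finBasis ℝ E₂
  -- The field `x ↦ t.symmL ℝ x w` is constant in the trivialization `t`, hence smooth near `x₀`;
  -- such fields for a basis form a local frame.
  have h1 (w : E₂) : ContMDiffAt 𝓘(ℝ, E₂) 𝓘(ℝ, ℝ) ∞ (fun x => s x (t.symmL ℝ x w)) x₀ := by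
    refine hs _ ?_
    refine (t.contMDiffAt_section_iff ht).2 ?_
    refine (contMDiffAt_const (c := w)).congr_of_eventuallyEq ?_
    filter_upwards [t.open_baseSet.mem_nhds ht] with x hx
    simp [hx, t.symmL_apply hx]
  have h2 : ContMDiffAt 𝓘(ℝ, E₂) 𝓘(ℝ, E₂ →L[ℝ] ℝ) ∞
      (fun x => ∑ i, s x (t.symmL ℝ x (b i)) • LinearMap.toContinuousLinearMap (b.coord i)) x₀ :=
    ContMDiffAt.sum fun i _ => (h1 (b i)).smul contMDiffAt_const
  refine (contMDiffAt_hom_bundle _).2 ⟨contMDiffAt_id, h2.congr_of_eventuallyEq ?_⟩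
  filter_upwards [t.open_baseSet.mem_nhds ht] with x hx
  refine ContinuousLinearMap.coe_injective (b.ext fun j => ?_)
  have h3 : (∑ i, s x (t.symmL ℝ x (b i)) • LinearMap.toContinuousLinearMap (b.coord i)) (b j) =
      s x (t.symmL ℝ x (b j)) := by
    simp [Finsupp.single_apply]
  refine Eq.trans ?_ h3.symm
  simp [ContinuousLinearMap.inCoordinates]
  rfl

end TangentMaps

/-! ### Tensorial maps on one-forms are pointwise -/

section Tensoriality

variable {F : Type*} [NormedAddCommGroup F] [NormedSpace ℝ F] [FiniteDimensional ℝ F]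
  {M : Type*} [TopologicalSpace M] [ChartedSpace F M] [IsManifold 𝓘(ℝ, F) ∞ M] [T2Space M]

/-- Near each point there are smooth one-forms `θ i` and functions `χ`, `c i` such that, for a given
one-form `α`, `χ α = ∑ c i θ i`. The coefficients vanish wherever `α` does. -/
theorem OneForm.exists_frame_expansion (x₀ : M) (α : OneForm F M) :
    ∃ (χ : C^∞⟮𝓘(ℝ, F), M; ℝ⟯) (n : ℕ) (c : Fin n → C^∞⟮𝓘(ℝ, F), M; ℝ⟯)
      (θ : Fin n → OneForm F M), χ x₀ = 1 ∧ (α x₀ = 0 → ∀ i, c i x₀ = 0) ∧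
      OneForm.smul χ α = ∑ i, OneForm.smul (c i) (θ i) := by
  let V : M → Type _ := fun x => CotangentSpace F M x
  let e := trivializationAt (F →L[ℝ] ℝ) V x₀
  have he : x₀ ∈ e.baseSet := FiberBundle.mem_baseSet_trivializationAt' x₀
  let b := Module.finBasis ℝ (F →L[ℝ] ℝ)
  obtain ⟨ψ, -, hψ⟩ := (SmoothBumpFunction.nhds_basis_tsupport (I := 𝓘(ℝ, F)) x₀).mem_iff.1
    (e.open_baseSet.mem_nhds he)
  have hθ (i) := ContMDiffOn.smul_section_of_tsupport (V := V) ψ.contMDiff.contMDiffOn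
    e.open_baseSet hψ (e.contMDiffOn_localFrame_baseSet (I := 𝓘(ℝ, F)) ∞ b i)
  have hc (i) := contMDiffOn_baseSet_localFrameCoeff (I := 𝓘(ℝ, F)) (e := e) (k := ∞) b
    (s := fun x => α x) α.contMDiff.contMDiffOn i
  have hc' (i) : ContMDiff 𝓘(ℝ, F) 𝓘(ℝ, ℝ) ∞
      (fun x => ψ x * e.localFrameCoeff 𝓘(ℝ, F) b i x (α x)) := by
    refine contMDiff_of_tsupport fun x hx => ?_
    have hx' : x ∈ e.baseSet := hψ (closure_mono (Function.support_mul_subset_left _ _) hx)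
    exact ψ.contMDiffAt.mul ((hc i).contMDiffAt (e.open_baseSet.mem_nhds hx'))
  -- One factor `ψ` extends the local coefficients to the whole of `M` and another extends the
  -- frame, whence `χ = ψ²`.
  refine ⟨⟨fun x => ψ x * ψ x, ψ.contMDiff.mul ψ.contMDiff⟩, _, fun i => ⟨_, hc' i⟩,
    fun i => ⟨_, hθ i⟩, ?_, fun h i => ?_, ?_⟩
  · change ψ x₀ * ψ x₀ = 1
    simp
  · change ψ x₀ * e.localFrameCoeff 𝓘(ℝ, F) b i x₀ (α x₀) = 0
    rw [h, map_zero, mul_zero]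
  · refine ContMDiffSection.ext fun x => ?_
    have hsum : (∑ i, OneForm.smul (⟨_, hc' i⟩ : C^∞⟮𝓘(ℝ, F), M; ℝ⟯) (⟨_, hθ i⟩ : OneForm F M)) x =
        ∑ i, (ψ x * e.localFrameCoeff 𝓘(ℝ, F) b i x (α x)) • ψ x • e.localFrame b i x := by
      have := map_sum (ContMDiffSection.coeAddHom 𝓘(ℝ, F) (F →L[ℝ] ℝ) ∞ V)
        (fun i => OneForm.smul (⟨_, hc' i⟩ : C^∞⟮𝓘(ℝ, F), M; ℝ⟯) (⟨_, hθ i⟩ : OneForm F M))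
        Finset.univ
      refine (congrFun this x).trans ?_
      rw [Finset.sum_apply]
      rfl
    refine Eq.trans ?_ hsum.symm
    change (ψ x * ψ x) • α x = _
    by_cases hx : x ∈ e.baseSet
    · conv_lhs => rw [e.eq_sum_localFrameCoeff_smul (I := 𝓘(ℝ, F)) (b := b)
        (s := fun x => α x) hx]
      rw [Finset.smul_sum]
      refine Finset.sum_congr rfl fun i _ => ?_
      rw [smul_smul, smul_smul]
      congr 1
      ring
    · have : ψ x = 0 := image_eq_zero_of_notMem_tsupport fun h => hx (hψ h)
      simp [this]

/-- A linear map on one-forms which is linear over the values at `x₀` of smooth functions vanishes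
on the one-forms vanishing at `x₀`. -/
theorem OneForm.eq_zero_of_tensorial {W : Type*} [AddCommGroup W] [Module ℝ W] {x₀ : M}
    (T : OneForm F M →ₗ[ℝ] W)
    (hT : ∀ (f : C^∞⟮𝓘(ℝ, F), M; ℝ⟯) α, T (OneForm.smul f α) = f x₀ • T α)
    {α : OneForm F M} (hα : α x₀ = 0) : T α = 0 := by
  obtain ⟨χ, n, c, θ, h1, h2, h3⟩ := OneForm.exists_frame_expansion x₀ α
  -- Since `χ x₀ = 1`, multiplying `α` by `χ` does not change the value of `T`, so `T` may be
  -- computed on the global expansion.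
  have h4 := hT χ α
  rw [h1, one_smul] at h4
  rw [← h4, h3, map_sum]
  refine Finset.sum_eq_zero fun i _ => ?_
  rw [hT, h2 hα i, zero_smul]

/-- Every covector is the value of a smooth one-form. -/
theorem OneForm.exists_apply_eq (x₀ : M) (η : CotangentSpace F M x₀) :
    ∃ α : OneForm F M, α x₀ = η := by
  let V : M → Type _ := fun x => CotangentSpace F M x
  let e := trivializationAt (F →L[ℝ] ℝ) V x₀
  have he : x₀ ∈ e.baseSet := FiberBundle.mem_baseSet_trivializationAt' x₀
  obtain ⟨ψ, -, hψ⟩ := (SmoothBumpFunction.nhds_basis_tsupport (I := 𝓘(ℝ, F)) x₀).mem_iff.1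
    (e.open_baseSet.mem_nhds he)
  obtain ⟨w, hw⟩ : ∃ w, w = (e ⟨x₀, η⟩).2 := ⟨_, rfl⟩
  have hs : ContMDiffOn 𝓘(ℝ, F) (𝓘(ℝ, F).prod 𝓘(ℝ, F →L[ℝ] ℝ)) ∞
      (fun x => Bundle.TotalSpace.mk' (F →L[ℝ] ℝ) (E := V) x (e.symm x w)) e.baseSet := by
    intro x hx
    refine ContMDiffAt.contMDiffWithinAt ((e.contMDiffAt_section_iff hx).2 ?_)
    refine (contMDiffAt_const (c := w)).congr_of_eventuallyEq ?_
    filter_upwards [e.open_baseSet.mem_nhds hx] with x hx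
    simp [e.apply_mk_symm hx]
  have hθ := ContMDiffOn.smul_section_of_tsupport (V := V) ψ.contMDiff.contMDiffOn
    e.open_baseSet hψ hs
  refine ⟨⟨_, hθ⟩, ?_⟩
  change ψ x₀ • e.symm x₀ w = η
  rw [ψ.eq_one, one_smul, hw, e.symm_apply_apply_mk he]

end Tensoriality

/-! ### The action of `G` on `G ⧸ H` and its derivatives -/

section Action

variable {E F : Type*} [NormedAddCommGroup E] [NormedSpace ℝ E]
  [NormedAddCommGroup F] [NormedSpace ℝ F] [FiniteDimensional ℝ F]
  {G : Type*} [TopologicalSpace G] [Group G] [ChartedSpace E G] [LieGroup 𝓘(ℝ, E) ∞ G]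
  {H : Subgroup G} [ChartedSpace F (G ⧸ H)] [IsManifold 𝓘(ℝ, F) ∞ (G ⧸ H)]

theorem smul_mk_one (g : G) : g • ((1 : G) : G ⧸ H) = (g : G ⧸ H) :=
  congrArg QuotientGroup.mk (mul_one g)

theorem mem_smul_mk_one {a : G} (ha : a ∈ H) : a • ((1 : G) : G ⧸ H) = ((1 : G) : G ⧸ H) := by
  rw [smul_mk_one]
  exact QuotientGroup.eq.2 (by simpa using ha)

/-- The action `G × G ⧸ H → G ⧸ H` is smooth. -/
theorem contMDiff_quotient_smul [IsQuotientManifold E F H] :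
    ContMDiff (𝓘(ℝ, E).prod 𝓘(ℝ, F)) 𝓘(ℝ, F) ∞ (fun z : G × (G ⧸ H) => z.1 • z.2) := by
  rintro ⟨g, x⟩
  obtain ⟨k, rfl⟩ := QuotientGroup.mk_surjective x
  have hp := IsQuotientManifold.contMDiff_mk (E := E) (F := F) (H := H)
  obtain ⟨σ, h1, h2, h3⟩ := exists_contMDiffAt_localSection (hp k)
    (IsQuotientManifold.surjective_mfderiv_mk (E := E) (F := F) (H := H) k)
  have h4 : ContMDiffAt (𝓘(ℝ, E).prod 𝓘(ℝ, F)) 𝓘(ℝ, E) ∞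
      (fun z : G × (G ⧸ H) => z.1 * σ z.2) (g, (k : G ⧸ H)) :=
    contMDiffAt_fst.mul (ContMDiffAt.comp (g, (k : G ⧸ H)) h1 contMDiffAt_snd)
  refine (ContMDiffAt.comp (g, (k : G ⧸ H)) (hp _) h4).congr_of_eventuallyEq ?_
  filter_upwards [continuousAt_snd.eventually h3] with z hz
  conv_lhs => rw [← hz]
  rfl

variable (F) in
/-- The derivative at `x` of the translation by `g`, in the model fibre. -/
def translationDeriv (g : G) (x : G ⧸ H) : F →L[ℝ] F :=
  mfderiv 𝓘(ℝ, F) 𝓘(ℝ, F) (fun y : G ⧸ H => g • y) x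

variable (E) in
theorem mdifferentiableAt_smul_left [IsQuotientManifold E F H] (g : G) (x : G ⧸ H) :
    MDifferentiableAt 𝓘(ℝ, F) 𝓘(ℝ, F) (fun y : G ⧸ H => g • y) x :=
  (contMDiff_smul_left E F H g x).mdifferentiableAt (by simp)

variable (E) in
theorem translationDeriv_mul [IsQuotientManifold E F H] (g k : G) (x : G ⧸ H) :
    translationDeriv F (g * k) x =
      (translationDeriv F g (k • x)).comp (translationDeriv F k x) := by
  have h := mfderiv_comp x (mdifferentiableAt_smul_left (F := F) E g (k • x))
    (mdifferentiableAt_smul_left (F := F) E k x)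
  refine Eq.trans ?_ h
  exact mfderiv_congr (by ext y; exact mul_smul g k y)

theorem translationDeriv_one (x : G ⧸ H) :
    translationDeriv F (1 : G) x = ContinuousLinearMap.id ℝ F :=
  (mfderiv_congr (by ext y; exact one_smul G y)).trans mfderiv_id

variable (E) in
theorem translationDeriv_inv_apply [IsQuotientManifold E F H] (g : G) (x : G ⧸ H) (w : F) :
    translationDeriv F g⁻¹ (g • x) (translationDeriv F g x w) = w := by
  have h := translationDeriv_mul (F := F) E g⁻¹ g x
  rw [inv_mul_cancel, translationDeriv_one] at h
  exact (DFunLike.congr_fun h w).symm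

variable (E) in
theorem translationDeriv_apply_inv [IsQuotientManifold E F H] (g : G) (x : G ⧸ H) (w : F) :
    translationDeriv F g x (translationDeriv F g⁻¹ (g • x) w) = w := by
  have h := translationDeriv_mul (F := F) E g g⁻¹ (g • x)
  rw [mul_inv_cancel, translationDeriv_one, inv_smul_smul] at h
  exact (DFunLike.congr_fun h w).symm

/-- For `φ : G → ℝ` smooth, `g ↦ d(φ ∘ L_g)_1 u` is smooth. -/
theorem contMDiff_mfderiv_mul_left {φ : G → ℝ} (hφ : ContMDiff 𝓘(ℝ, E) 𝓘(ℝ, ℝ) ∞ φ) (u : E) :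
    ContMDiff 𝓘(ℝ, E) 𝓘(ℝ, ℝ) ∞ (fun g : G =>
      (mfderiv 𝓘(ℝ, E) 𝓘(ℝ, ℝ) (fun k : G => φ (g * k)) 1 : E →L[ℝ] ℝ) u) := by
  intro g
  have h := contMDiffAt_mfderiv_apply_section (E₁ := E) (E₂ := E) (E₃ := ℝ) (n₀ := g)
    -- The base point `1` and the vector `u` stay fixed; `g` enters only as a parameter of the map
    -- being differentiated.
    (f := fun g k : G => φ (g * k)) (g := fun _ : G => (1 : G)) (v := fun _ => u)
    ((hφ.comp (contMDiff_mul 𝓘(ℝ, E) ∞)) _) contMDiffAt_const contMDiffAt_const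
  exact (contMDiff_snd_tangentBundle_modelSpace ℝ 𝓘(ℝ, ℝ)).contMDiffAt.comp g h

end Action

/-! ### One-forms as equivariant functions on `G` -/

section FormFunction

variable {E F : Type*} [NormedAddCommGroup E] [NormedSpace ℝ E]
  [NormedAddCommGroup F] [NormedSpace ℝ F] [FiniteDimensional ℝ F]
  {G : Type*} [TopologicalSpace G] [Group G] [ChartedSpace E G] [LieGroup 𝓘(ℝ, E) ∞ G]
  {H : Subgroup G} [ChartedSpace F (G ⧸ H)] [IsManifold 𝓘(ℝ, F) ∞ (G ⧸ H)]
  [IsQuotientManifold E F H] {𝔪 : Submodule ℝ (GroupLieAlgebra 𝓘(ℝ, E) G)}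
  (h : IsReductiveComplement H 𝔪)

/-- The restriction of `Ad_a` to `𝔪`, for `a ∈ H`. -/
def adRestrict (h : IsReductiveComplement H 𝔪) (a : H) : 𝔪 →ₗ[ℝ] 𝔪 :=
  (Ad E (a : G)).toLinearMap.restrict (p := 𝔪) (q := 𝔪)
    fun _ hu => (h.map_Ad a a.2).le (Submodule.mem_map_of_mem hu)

theorem coAd_apply (a : H) (η : Module.Dual ℝ 𝔪) (v : 𝔪) :
    coAd h a η v = η (adRestrict h a v) := rfl

variable (F) in
/-- The identification `𝔪 ≃ T_ē(G ⧸ H)`, with values in the model fibre. -/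
def baseEquiv : 𝔪 ≃ₗ[ℝ] F := baseTangentEquiv (F := F) h

theorem baseEquiv_apply (v : 𝔪) :
    baseEquiv F h v =
      -(mfderiv 𝓘(ℝ, E) 𝓘(ℝ, F) (QuotientGroup.mk : G → G ⧸ H) 1 : E →L[ℝ] F) ((v : GroupLieAlgebra 𝓘(ℝ, E) G) : E) :=
  baseFundamental_apply (F := F) (H := H) (v : GroupLieAlgebra 𝓘(ℝ, E) G)

/-- `T_ē λ_a (u^*_ē) = (Ad_a u)^*_ē` for `a ∈ H`. -/
theorem translationDeriv_baseEquiv (a : H) (v : 𝔪) :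
    translationDeriv F (a : G) ((1 : G) : G ⧸ H) (baseEquiv F h v) =
      baseEquiv F h (adRestrict h a v) := by
  have hp := IsQuotientManifold.contMDiff_mk (E := E) (F := F) (H := H)
  have hpd (g : G) : MDifferentiableAt 𝓘(ℝ, E) 𝓘(ℝ, F) (QuotientGroup.mk : G → G ⧸ H) g :=
    (hp g).mdifferentiableAt (by simp)
  have hconj : MDifferentiableAt 𝓘(ℝ, E) 𝓘(ℝ, E) (fun x : G => (a : G) * x * (a : G)⁻¹) 1 := by
    have : ContMDiff 𝓘(ℝ, E) 𝓘(ℝ, E) ∞ (fun x : G => (a : G) * x * (a : G)⁻¹) :=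
      (contMDiff_const.mul contMDiff_id).mul contMDiff_const
    exact (this 1).mdifferentiableAt (by simp)
  have h1 := mfderiv_comp (1 : G) (mdifferentiableAt_smul_left E (a : G) ((1 : G) : G ⧸ H)) (hpd 1)
  have h2 := mfderiv_comp (1 : G) (hpd _) hconj
  -- Right multiplication by `a⁻¹ ∈ H` is invisible in `G ⧸ H`, so `λ_a` lifts to conjugation by
  -- `a`, whose derivative at `1` is `Ad_a`.
  have h3 : ((fun y : G ⧸ H => (a : G) • y) ∘ (QuotientGroup.mk : G → G ⧸ H)) =
      (QuotientGroup.mk : G → G ⧸ H) ∘ (fun x : G => (a : G) * x * (a : G)⁻¹) := by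
    ext x
    exact QuotientGroup.eq.2 (by simp [mul_assoc])
  have h4 : @Eq (E →L[ℝ] F) (mfderiv 𝓘(ℝ, E) 𝓘(ℝ, F) (QuotientGroup.mk : G → G ⧸ H)
        ((a : G) * 1 * (a : G)⁻¹))
      (mfderiv 𝓘(ℝ, E) 𝓘(ℝ, F) (QuotientGroup.mk : G → G ⧸ H) 1) :=
    mfderiv_congr_point (by simp)
  have h5 : @Eq (E →L[ℝ] F) _ _ := h1.symm.trans ((mfderiv_congr h3).trans h2)
  have h6 := DFunLike.congr_fun h5 ((v : GroupLieAlgebra 𝓘(ℝ, E) G) : E)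
  rw [baseEquiv_apply, baseEquiv_apply]
  refine (map_neg (translationDeriv F (a : G) ((1 : G) : G ⧸ H)) _).trans ?_
  refine congrArg (fun z : F => -z) (h6.trans ?_)
  exact DFunLike.congr_fun h4 _

theorem formFunction_apply (β : OneForm F (G ⧸ H)) (g : G) (v : 𝔪) :
    formFunction h β g v = (β (g • ((1 : G) : G ⧸ H)) : F →L[ℝ] ℝ)
      (translationDeriv F g ((1 : G) : G ⧸ H) (baseEquiv F h v)) := by
  have : formFunction h β g v = (β (g⁻¹⁻¹ • ((1 : G) : G ⧸ H)) : F →L[ℝ] ℝ)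
      (translationDeriv F g⁻¹⁻¹ ((1 : G) : G ⧸ H) (baseEquiv F h v)) := rfl
  rw [this, inv_inv]

theorem formFunction_one (β : OneForm F (G ⧸ H)) :
    formFunction h β 1 = baseCotangent h (β ((1 : G) : G ⧸ H)) := by
  ext v
  rw [formFunction_apply, translationDeriv_one, one_smul]
  rfl

theorem formFunction_act (β : OneForm F (G ⧸ H)) (g k : G) :
    formFunction h (act E F H g β) k = formFunction h β (g⁻¹ * k) := by
  ext v
  rw [formFunction_apply, formFunction_apply, translationDeriv_mul E, mul_smul]
  rfl

/-- Since `a` fixes `ē`, the chain rule gives `T_ē λ_{ga} = T_ē λ_g ∘ T_ē λ_a`, and the last factor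
is `Ad_a` on `𝔪`. -/
theorem formFunction_mul_mem (β : OneForm F (G ⧸ H)) (g : G) (a : H) :
    formFunction h β (g * a) = coAd h a (formFunction h β g) := by
  ext v
  rw [coAd_apply, formFunction_apply, formFunction_apply, translationDeriv_mul E, mul_smul,
    mem_smul_mk_one a.2, ContinuousLinearMap.comp_apply, translationDeriv_baseEquiv]

theorem contMDiff_formFunction (β : OneForm F (G ⧸ H)) (v : 𝔪) :
    ContMDiff 𝓘(ℝ, E) 𝓘(ℝ, ℝ) ∞ (fun g : G => formFunction h β g v) := by
  intro g
  have h1 := contMDiffAt_mfderiv_apply_section (n₀ := g) (E₁ := E) (E₂ := F) (E₃ := F)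
    (f := fun (g : G) (x : G ⧸ H) => g • x) (g := fun _ : G => ((1 : G) : G ⧸ H))
    (v := fun _ => baseEquiv F h v)
    (contMDiff_quotient_smul _) contMDiffAt_const contMDiffAt_const
  refine (contMDiffAt_oneForm_apply (α := β) h1).congr_of_eventuallyEq ?_
  exact Filter.Eventually.of_forall fun g => formFunction_apply h β g v

/-- Every point is some `g • ē`, and `T_ē λ_g` is invertible, so `F^β(g)` recovers `β` there. -/
theorem formFunction_injective :
    Function.Injective (formFunction h : OneForm F (G ⧸ H) → G → Module.Dual ℝ 𝔪) := by
  intro α β hαβ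
  refine ContMDiffSection.ext fun x => ?_
  obtain ⟨g, rfl⟩ := QuotientGroup.mk_surjective x
  rw [← smul_mk_one]
  refine ContinuousLinearMap.ext fun (w : F) => ?_
  have h1 := DFunLike.congr_fun (congrFun hαβ g)
    ((baseEquiv F h).symm (translationDeriv F g⁻¹ (g • ((1 : G) : G ⧸ H)) w))
  rw [formFunction_apply, formFunction_apply, LinearEquiv.apply_symm_apply,
    translationDeriv_apply_inv E] at h1
  exact h1

theorem formFunction_add (α β : OneForm F (G ⧸ H)) (g : G) :
    formFunction h (α + β) g = formFunction h α g + formFunction h β g := by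
  ext v
  rw [LinearMap.add_apply]
  simp only [formFunction_apply]
  rfl

theorem formFunction_const_smul (c : ℝ) (β : OneForm F (G ⧸ H)) (g : G) :
    formFunction h (c • β) g = c • formFunction h β g := by
  ext v
  rw [LinearMap.smul_apply]
  simp only [formFunction_apply]
  rfl

theorem formFunction_smul (f : C^∞⟮𝓘(ℝ, F), G ⧸ H; ℝ⟯) (β : OneForm F (G ⧸ H)) (g : G) :
    formFunction h (OneForm.smul f β) g = f (g : G ⧸ H) • formFunction h β g := by
  ext v
  rw [LinearMap.smul_apply]
  rw [formFunction_apply, formFunction_apply, ← smul_mk_one (H := H) g]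
  rfl

end FormFunction

/-! ### From equivariant functions back to one-forms -/

section OfEquivariant

variable {E F : Type*} [NormedAddCommGroup E] [NormedSpace ℝ E]
  [NormedAddCommGroup F] [NormedSpace ℝ F] [FiniteDimensional ℝ F]
  {G : Type*} [TopologicalSpace G] [Group G] [ChartedSpace E G] [LieGroup 𝓘(ℝ, E) ∞ G]
  {H : Subgroup G} [ChartedSpace F (G ⧸ H)] [IsManifold 𝓘(ℝ, F) ∞ (G ⧸ H)]
  [IsQuotientManifold E F H] {𝔪 : Submodule ℝ (GroupLieAlgebra 𝓘(ℝ, E) G)}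
  (h : IsReductiveComplement H 𝔪)

variable (F) in
/-- The covector at `ē` corresponding to `η ∈ 𝔪^*`. -/
def baseCovector : Module.Dual ℝ 𝔪 →ₗ[ℝ] (F →L[ℝ] ℝ) :=
  LinearMap.toContinuousLinearMap.toLinearMap ∘ₗ
    Module.Dual.transpose (baseEquiv F h).symm.toLinearMap

theorem baseCovector_apply (η : Module.Dual ℝ 𝔪) (w : F) :
    baseCovector F h η w = η ((baseEquiv F h).symm w) := rfl

theorem baseCotangent_baseCovector (η : Module.Dual ℝ 𝔪) :
    baseCotangent (F := F) h (baseCovector F h η) = η := by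
  ext v
  exact congrArg η ((baseEquiv F h).symm_apply_apply v)

theorem baseCovector_baseCotangent (α : CotangentSpace F (G ⧸ H) ((1 : G) : G ⧸ H)) :
    baseCovector F h (baseCotangent h α) = α := by
  refine ContinuousLinearMap.ext fun (w : F) => ?_
  exact congrArg α ((baseEquiv F h).apply_symm_apply w)

/-- The translate to `x` of the covector given at `g⁻¹ x = ē` by `ψ g`. -/
def equivariantCovector (ψ : G → Module.Dual ℝ 𝔪) (x : G ⧸ H) : CotangentSpace F (G ⧸ H) x :=
  (baseCovector F h (ψ (Quotient.out x))).comp (translationDeriv F (Quotient.out x)⁻¹ x)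

/-- The covector does not depend on the representative: `Quotient.out` returns some `ga` with `a ∈
H`, and the `Ad_a^*` coming from `ψ(ga)` matches the factor `T_ē λ_a` by which the derivatives of
`λ_{g⁻¹}` and `λ_{(ga)⁻¹}` differ. -/
theorem equivariantCovector_mk {ψ : G → Module.Dual ℝ 𝔪}
    (hψ : ∀ (g : G) (a : H), ψ (g * a) = coAd h a (ψ g)) (g : G) :
    equivariantCovector (F := F) h ψ (g : G ⧸ H) =
      (baseCovector F h (ψ g)).comp (translationDeriv F g⁻¹ (g : G ⧸ H)) := by
  obtain ⟨a, ha⟩ := QuotientGroup.mk_out_eq_mul H g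
  obtain ⟨k, hk⟩ : ∃ k, k = Quotient.out (g : G ⧸ H) := ⟨_, rfl⟩
  have h1 : equivariantCovector (F := F) h ψ (g : G ⧸ H) =
      (baseCovector F h (ψ k)).comp (translationDeriv F k⁻¹ (g : G ⧸ H)) := by rw [hk]; rfl
  have h2 : k = g * a := hk.trans ha
  rw [h1, h2]
  refine ContinuousLinearMap.ext fun (w : F) => ?_
  have h3 : g⁻¹ = (a : G) * (g * a)⁻¹ := by simp
  have h4 : (g * (a : G))⁻¹ • (g : G ⧸ H) = ((1 : G) : G ⧸ H) := by
    rw [inv_smul_eq_iff, mul_smul, mem_smul_mk_one a.2, smul_mk_one]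
  conv_rhs => rw [h3]
  rw [ContinuousLinearMap.comp_apply, ContinuousLinearMap.comp_apply, translationDeriv_mul E, h4,
    ContinuousLinearMap.comp_apply, hψ, baseCovector_apply, baseCovector_apply, coAd_apply]
  obtain ⟨z, hz⟩ := (baseEquiv F h).surjective (translationDeriv F (g * (a : G))⁻¹ (g : G ⧸ H) w)
  rw [← hz, translationDeriv_baseEquiv, LinearEquiv.symm_apply_apply, LinearEquiv.symm_apply_apply]

variable [T2Space (G ⧸ H)]

/-- With a smooth local section `σ` of `G → G ⧸ H`, the covector at `y` is the pullback along
`λ_{σ(y)⁻¹}` of a combination of fixed covectors at `ē` with smooth coefficients `ψ(σ y)(b_i)`. -/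
theorem contMDiff_equivariantCovector {ψ : G → Module.Dual ℝ 𝔪}
    (hψ : ∀ (g : G) (a : H), ψ (g * a) = coAd h a (ψ g))
    (hs : ∀ v, ContMDiff 𝓘(ℝ, E) 𝓘(ℝ, ℝ) ∞ (fun g => ψ g v)) :
    ContMDiff 𝓘(ℝ, F) (𝓘(ℝ, F).prod 𝓘(ℝ, F →L[ℝ] ℝ)) ∞
      (fun x => Bundle.TotalSpace.mk' (F →L[ℝ] ℝ) (E := fun x : G ⧸ H => CotangentSpace F (G ⧸ H) x)
        x (equivariantCovector h ψ x)) := by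
  intro x
  obtain ⟨g, rfl⟩ := QuotientGroup.mk_surjective x
  have hp := IsQuotientManifold.contMDiff_mk (E := E) (F := F) (H := H)
  obtain ⟨σ, h1, h2, h3⟩ := exists_contMDiffAt_localSection (hp g)
    (IsQuotientManifold.surjective_mfderiv_mk (E := E) (F := F) (H := H) g)
  have : FiniteDimensional ℝ 𝔪 := Module.Finite.equiv (baseEquiv F h).symm
  let b := Module.finBasis ℝ 𝔪
  -- Only the values of the `θ i` at `ē` matter: they extend the dual basis to smooth one-forms, so
  -- that pairings can be shown smooth in `y`.
  choose θ hθ using fun i => OneForm.exists_apply_eq ((1 : G) : G ⧸ H) (baseCovector F h (b.coord i))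
  refine contMDiffAt_cotangent_of_apply fun v hv => ?_
  have h4 := contMDiffAt_mfderiv_apply_section (n₀ := (g : G ⧸ H)) (E₁ := F) (E₂ := F) (E₃ := F)
    (f := fun (y z : G ⧸ H) => (σ y)⁻¹ • z) (g := fun y => y) (v := v)
    (ContMDiffAt.comp ((g : G ⧸ H), (g : G ⧸ H))
      (g := fun z : G × (G ⧸ H) => z.1 • z.2) (f := fun z : (G ⧸ H) × (G ⧸ H) => ((σ z.1)⁻¹, z.2))
      (contMDiff_quotient_smul (E := E) _)
      ((ContMDiffAt.comp ((g : G ⧸ H), (g : G ⧸ H)) h1 contMDiffAt_fst).inv.prodMk contMDiffAt_snd))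
    contMDiffAt_id hv
  have h5 (i) := contMDiffAt_oneForm_apply (α := θ i) h4
  have h6 (i) : ContMDiffAt 𝓘(ℝ, F) 𝓘(ℝ, ℝ) ∞ (fun y => ψ (σ y) (b i)) (g : G ⧸ H) :=
    ContMDiffAt.comp (g : G ⧸ H) (hs (b i) _) h1
  refine (ContMDiffAt.sum (t := Finset.univ) fun i _ => (h6 i).mul (h5 i)).congr_of_eventuallyEq ?_
  filter_upwards [h3] with y hy
  have h7 : (σ y)⁻¹ • y = ((1 : G) : G ⧸ H) := by
    rw [inv_smul_eq_iff, smul_mk_one, hy]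
  have h8 : (equivariantCovector h ψ y : F →L[ℝ] ℝ) =
      (baseCovector F h (ψ (σ y))).comp (translationDeriv F (σ y)⁻¹ y) := by
    have := equivariantCovector_mk (F := F) h hψ (σ y)
    rwa [hy] at this
  have h9 (i) : ((θ i) ((σ y)⁻¹ • y) : F →L[ℝ] ℝ) = baseCovector F h (b.coord i) := by
    rw [h7]; exact hθ i
  have h10 (η : Module.Dual ℝ 𝔪) (w : F) :
      baseCovector F h η w = ∑ i, η (b i) * baseCovector F h (b.coord i) w := by
    conv_lhs => rw [← b.sum_dual_apply_smul_coord η, map_sum, sum_apply]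
    simp
  refine (DFunLike.congr_fun h8 (v y)).trans ((h10 _ _).trans ?_)
  refine Finset.sum_congr rfl fun i _ => ?_
  exact congrArg (ψ (σ y) (b i) * ·) (DFunLike.congr_fun (h9 i) _).symm

/-- The one-form with a given smooth equivariant function `G → 𝔪^*`. -/
theorem exists_formFunction_eq {ψ : G → Module.Dual ℝ 𝔪}
    (hψ : ∀ (g : G) (a : H), ψ (g * a) = coAd h a (ψ g))
    (hs : ∀ v, ContMDiff 𝓘(ℝ, E) 𝓘(ℝ, ℝ) ∞ (fun g => ψ g v)) :
    ∃ β : OneForm F (G ⧸ H), formFunction h β = ψ := by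
  refine ⟨⟨_, contMDiff_equivariantCovector h hψ hs⟩, ?_⟩
  ext g v
  rw [formFunction_apply]
  have h1 := equivariantCovector_mk (F := F) h hψ g
  rw [← smul_mk_one] at h1
  refine (DFunLike.congr_fun h1 _).trans ?_
  refine (congrArg (baseCovector F h (ψ g)) (translationDeriv_inv_apply E g _ _)).trans ?_
  rw [baseCovector_apply, LinearEquiv.symm_apply_apply]

end OfEquivariant

/-! ### Derivatives along left-invariant vector fields -/

section LeftDeriv

variable {E : Type*} [NormedAddCommGroup E] [NormedSpace ℝ E]
  {G : Type*} [TopologicalSpace G] [Group G] [ChartedSpace E G] [LieGroup 𝓘(ℝ, E) ∞ G]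

variable (E) in
/-- The derivative of `φ` at `g` along the left-invariant vector fields. -/
def leftDeriv (φ : G → ℝ) (g : G) : E →L[ℝ] ℝ :=
  mfderiv 𝓘(ℝ, E) 𝓘(ℝ, ℝ) (fun k : G => φ (g * k)) 1

theorem hasMFDerivAt_leftDeriv {φ : G → ℝ} (hφ : ContMDiff 𝓘(ℝ, E) 𝓘(ℝ, ℝ) ∞ φ) (g : G) :
    HasMFDerivAt 𝓘(ℝ, E) 𝓘(ℝ, ℝ) (fun k : G => φ (g * k)) 1 (leftDeriv E φ g) :=
  ((hφ.comp (contMDiff_mul_left (I := 𝓘(ℝ, E)) (n := ∞) (a := g)) 1).mdifferentiableAt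
    (by simp)).hasMFDerivAt

theorem leftDeriv_add {φ χ : G → ℝ} (hφ : ContMDiff 𝓘(ℝ, E) 𝓘(ℝ, ℝ) ∞ φ)
    (hχ : ContMDiff 𝓘(ℝ, E) 𝓘(ℝ, ℝ) ∞ χ) (g : G) :
    leftDeriv E (fun k => φ k + χ k) g = leftDeriv E φ g + leftDeriv E χ g :=
  ((hasMFDerivAt_leftDeriv hφ g).add (hasMFDerivAt_leftDeriv hχ g)).mfderiv

theorem leftDeriv_const_mul {φ : G → ℝ} (hφ : ContMDiff 𝓘(ℝ, E) 𝓘(ℝ, ℝ) ∞ φ) (c : ℝ) (g : G) :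
    leftDeriv E (fun k => c * φ k) g = c • leftDeriv E φ g :=
  ((hasMFDerivAt_leftDeriv hφ g).const_smul c).mfderiv

theorem leftDeriv_mul {φ χ : G → ℝ} (hφ : ContMDiff 𝓘(ℝ, E) 𝓘(ℝ, ℝ) ∞ φ)
    (hχ : ContMDiff 𝓘(ℝ, E) 𝓘(ℝ, ℝ) ∞ χ) (g : G) :
    leftDeriv E (fun k => φ k * χ k) g = φ g • leftDeriv E χ g + χ g • leftDeriv E φ g := by
  have h1 := ((hasMFDerivAt_leftDeriv hφ g).mul (hasMFDerivAt_leftDeriv hχ g)).mfderiv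
  rw [mul_one] at h1
  exact h1

theorem leftDeriv_mul_left (φ : G → ℝ) (g k : G) :
    leftDeriv E (fun l => φ (g * l)) k = leftDeriv E φ (g * k) :=
  mfderiv_congr (by ext l; rw [mul_assoc])

theorem leftDeriv_one (φ : G → ℝ) :
    leftDeriv E φ 1 = (mfderiv 𝓘(ℝ, E) 𝓘(ℝ, ℝ) φ 1 : E →L[ℝ] ℝ) :=
  mfderiv_congr (by ext l; rw [one_mul])

/-- Here `Ad` enters the calculus on `G`: conjugating the argument amounts, by the chain rule at
`1`, to turning the direction of differentiation by `Ad_a`. -/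
theorem leftDeriv_comp_conj {φ : G → ℝ} (hφ : ContMDiff 𝓘(ℝ, E) 𝓘(ℝ, ℝ) ∞ φ) (g a : G) :
    (mfderiv 𝓘(ℝ, E) 𝓘(ℝ, ℝ) (fun k : G => φ (g * (a * k * a⁻¹))) 1 : E →L[ℝ] ℝ) =
      (leftDeriv E φ g).comp (Ad E a : E →L[ℝ] E) := by
  have hconj : ContMDiff 𝓘(ℝ, E) 𝓘(ℝ, E) ∞ (fun x : G => a * x * a⁻¹) :=
    (contMDiff_const.mul contMDiff_id).mul contMDiff_const
  have h1 : HasMFDerivAt 𝓘(ℝ, E) 𝓘(ℝ, ℝ) (fun k : G => φ (g * k)) (a * 1 * a⁻¹)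
      (leftDeriv E φ g) := by
    rw [mul_one, mul_inv_cancel]
    exact hasMFDerivAt_leftDeriv hφ g
  exact (h1.comp (1 : G) ((hconj 1).mdifferentiableAt (by simp)).hasMFDerivAt).mfderiv

end LeftDeriv

/-! ### Derivatives of `F^β` in the directions of `𝔪` -/

section FormDeriv

variable {E F : Type*} [NormedAddCommGroup E] [NormedSpace ℝ E]
  [NormedAddCommGroup F] [NormedSpace ℝ F] [FiniteDimensional ℝ F]
  {G : Type*} [TopologicalSpace G] [Group G] [ChartedSpace E G] [LieGroup 𝓘(ℝ, E) ∞ G]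
  {H : Subgroup G} [ChartedSpace F (G ⧸ H)] [IsManifold 𝓘(ℝ, F) ∞ (G ⧸ H)]
  [IsQuotientManifold E F H] {𝔪 : Submodule ℝ (GroupLieAlgebra 𝓘(ℝ, E) G)}
  (h : IsReductiveComplement H 𝔪)

/-- The inclusion of `𝔪` in the model fibre of `G`. -/
def complementIncl (𝔪 : Submodule ℝ (GroupLieAlgebra 𝓘(ℝ, E) G)) : 𝔪 →ₗ[ℝ] E := 𝔪.subtype

/-- The derivative of `F^β` at `g` along the right-translation by `exp(-tu)`, for `u ∈ 𝔪`. -/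
def formDeriv (β : OneForm F (G ⧸ H)) (g : G) : 𝔪 →ₗ[ℝ] Module.Dual ℝ 𝔪 :=
  LinearMap.mk₂ ℝ (fun u v => leftDeriv E (fun k => formFunction h β k v) g (-complementIncl 𝔪 u))
    (fun u u' v => by rw [map_add, neg_add, map_add])
    (fun c u v => by rw [map_smul, ← smul_neg, map_smul])
    (fun u v v' => by
      simp only [map_add]
      rw [leftDeriv_add (contMDiff_formFunction h β v) (contMDiff_formFunction h β v')]
      rfl)
    (fun c u v => by
      simp only [map_smul, smul_eq_mul]
      rw [leftDeriv_const_mul (contMDiff_formFunction h β v)]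
      rfl)

theorem formDeriv_apply (β : OneForm F (G ⧸ H)) (g : G) (u v : 𝔪) :
    formDeriv h β g u v =
      leftDeriv E (fun k => formFunction h β k v) g (-complementIncl 𝔪 u) := rfl

theorem formDeriv_one_apply (β : OneForm F (G ⧸ H)) (u v : 𝔪) :
    formDeriv h β 1 u v = dualDeriv u (formFunction h β) v := by
  rw [formDeriv_apply, leftDeriv_one]
  rfl

theorem formDeriv_act (β : OneForm F (G ⧸ H)) (g k : G) :
    formDeriv h (act E F H g β) k = formDeriv h β (g⁻¹ * k) := by
  ext u v
  rw [formDeriv_apply, formDeriv_apply, ← leftDeriv_mul_left]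
  simp only [formFunction_act]

theorem formDeriv_add (α β : OneForm F (G ⧸ H)) (g : G) :
    formDeriv h (α + β) g = formDeriv h α g + formDeriv h β g := by
  ext u v
  rw [LinearMap.add_apply, LinearMap.add_apply]
  simp only [formDeriv_apply, formFunction_add, LinearMap.add_apply]
  rw [leftDeriv_add (contMDiff_formFunction h α v) (contMDiff_formFunction h β v)]
  rfl

theorem formDeriv_const_smul (c : ℝ) (β : OneForm F (G ⧸ H)) (g : G) :
    formDeriv h (c • β) g = c • formDeriv h β g := by
  ext u v
  rw [LinearMap.smul_apply, LinearMap.smul_apply]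
  simp only [formDeriv_apply, formFunction_const_smul, LinearMap.smul_apply, smul_eq_mul]
  rw [leftDeriv_const_mul (contMDiff_formFunction h β v)]
  rfl

theorem contMDiff_formDeriv (β : OneForm F (G ⧸ H)) (u v : 𝔪) :
    ContMDiff 𝓘(ℝ, E) 𝓘(ℝ, ℝ) ∞ (fun g => formDeriv h β g u v) :=
  contMDiff_mfderiv_mul_left (contMDiff_formFunction h β v) _

/-- From `gak = g(aka⁻¹)a`: the conjugation turns the direction `u` into `Ad_a u`, which stays in
`𝔪` by reductivity, and the trailing `a` acts on the value through the equivariance of `F^β`. -/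
theorem formDeriv_mul_mem (β : OneForm F (G ⧸ H)) (g : G) (a : H) (u : 𝔪) :
    formDeriv h β (g * a) u = coAd h a (formDeriv h β g (adRestrict h a u)) := by
  ext v
  rw [coAd_apply, formDeriv_apply, formDeriv_apply]
  have h1 : (fun k => formFunction h β (g * a * k) v) =
      fun k => formFunction h β (g * ((a : G) * k * (a : G)⁻¹)) (adRestrict h a v) := by
    ext k
    rw [← coAd_apply, ← formFunction_mul_mem]
    congr 2
    group
  have h2 : leftDeriv E (fun k => formFunction h β k v) (g * a) =
      (leftDeriv E (fun k => formFunction h β k (adRestrict h a v)) g).comp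
        (Ad E (a : G) : E →L[ℝ] E) :=
    (mfderiv_congr h1).trans
      (leftDeriv_comp_conj (contMDiff_formFunction h β (adRestrict h a v)) g (a : G))
  rw [h2]
  refine congrArg (leftDeriv E (fun k => formFunction h β k (adRestrict h a v)) g) ?_
  exact map_neg (Ad E (a : G) : E →L[ℝ] E) (complementIncl 𝔪 u)

/-- The derivative of `f ∘ p` along `u ∈ 𝔪` is the derivative of `f` along `T λ_g (u^*_ē)`. -/
theorem leftDeriv_comp_mk (f : C^∞⟮𝓘(ℝ, F), G ⧸ H; ℝ⟯) (g : G) (u : 𝔪) :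
    leftDeriv E (fun k : G => f (k : G ⧸ H)) g (-complementIncl 𝔪 u) =
      (dAt f (g • ((1 : G) : G ⧸ H)) : F →L[ℝ] ℝ)
        (translationDeriv F g ((1 : G) : G ⧸ H) (baseEquiv F h u)) := by
  have hp := IsQuotientManifold.contMDiff_mk (E := E) (F := F) (H := H)
  have h1 := ((f.contMDiff (g • ((1 : G) : G ⧸ H))).mdifferentiableAt (by simp)).hasMFDerivAt
  have h2 := (mdifferentiableAt_smul_left (F := F) E g ((1 : G) : G ⧸ H)).hasMFDerivAt
  have h3 := ((hp 1).mdifferentiableAt (by simp)).hasMFDerivAt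
  have h4 := ((h1.comp _ h2).comp (1 : G) h3).mfderiv
  rw [baseEquiv_apply]
  refine (DFunLike.congr_fun h4 _).trans ?_
  refine congrArg (fun w : F => (dAt f (g • ((1 : G) : G ⧸ H)) : F →L[ℝ] ℝ)
    (translationDeriv F g ((1 : G) : G ⧸ H) w)) ?_
  exact map_neg (mfderiv 𝓘(ℝ, E) 𝓘(ℝ, F) (QuotientGroup.mk : G → G ⧸ H) 1 : E →L[ℝ] F) _

/-- The product rule for `F^{fβ} = (f ∘ p) F^β`, with the derivative of `f ∘ p` expressed downstairs
by `leftDeriv_comp_mk`. -/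
theorem formDeriv_smul (f : C^∞⟮𝓘(ℝ, F), G ⧸ H; ℝ⟯) (β : OneForm F (G ⧸ H)) (g : G) (u : 𝔪) :
    formDeriv h (OneForm.smul f β) g u = f (g : G ⧸ H) • formDeriv h β g u +
      (dAt f (g • ((1 : G) : G ⧸ H)) : F →L[ℝ] ℝ)
        (translationDeriv F g ((1 : G) : G ⧸ H) (baseEquiv F h u)) • formFunction h β g := by
  have hp := IsQuotientManifold.contMDiff_mk (E := E) (F := F) (H := H)
  ext v
  rw [LinearMap.add_apply, LinearMap.smul_apply, LinearMap.smul_apply, formDeriv_apply,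
    formDeriv_apply, ← leftDeriv_comp_mk]
  simp only [formFunction_smul, LinearMap.smul_apply, smul_eq_mul]
  rw [leftDeriv_mul (φ := fun k : G => f (k : G ⧸ H)) (f.contMDiff.comp hp)
    (contMDiff_formFunction h β v), add_apply]
  simp [mul_comm]

end FormDeriv

/-! ### The derivative term defined by `π` -/

section Correspondence

variable {E F : Type*} [NormedAddCommGroup E] [NormedSpace ℝ E]
  [NormedAddCommGroup F] [NormedSpace ℝ F] [FiniteDimensional ℝ F]
  {G : Type*} [TopologicalSpace G] [Group G] [ChartedSpace E G] [LieGroup 𝓘(ℝ, E) ∞ G]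
  {H : Subgroup G} [ChartedSpace F (G ⧸ H)] [IsManifold 𝓘(ℝ, F) ∞ (G ⧸ H)]
  [IsQuotientManifold E F H] {𝔪 : Submodule ℝ (GroupLieAlgebra 𝓘(ℝ, E) G)}
  (h : IsReductiveComplement H 𝔪) (P : PoissonTensor F (G ⧸ H))

/-- The bundle map `α ↦ α^#` at `x`, in the model fibre. -/
def PoissonTensor.sharpAt (P : PoissonTensor F (G ⧸ H)) (x : G ⧸ H) : (F →L[ℝ] ℝ) →L[ℝ] F :=
  P.sharp x

/-- The map `𝔪^* → 𝔪` corresponding to `α ↦ α^#` at `ē`. -/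
def baseSharp : Module.Dual ℝ 𝔪 →ₗ[ℝ] 𝔪 :=
  (baseEquiv F h).symm.toLinearMap ∘ₗ (P.sharpAt ((1 : G) : G ⧸ H)).toLinearMap ∘ₗ
    baseCovector F h

theorem baseEquiv_baseSharp (η : Module.Dual ℝ 𝔪) :
    baseEquiv F h (baseSharp h P η) = P.sharpAt ((1 : G) : G ⧸ H) (baseCovector F h η) :=
  (baseEquiv F h).apply_symm_apply _

variable {P}

theorem sharpAt_smul (hP : P.IsInvariant) (g : G) (x : G ⧸ H) (α : F →L[ℝ] ℝ) :
    P.sharpAt (g • x) α =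
      translationDeriv F g x (P.sharpAt x (α.comp (translationDeriv F g x))) :=
  hP g x α

/-- This is the invariance of `π` under the isotropy group: `λ_a` fixes `ē`, and its derivative
there is `Ad_a`. -/
theorem adRestrict_baseSharp_coAd (hP : P.IsInvariant) (a : H) (η : Module.Dual ℝ 𝔪) :
    adRestrict h a (baseSharp h P (coAd h a η)) = baseSharp h P η := by
  apply (baseEquiv F h).injective
  rw [← translationDeriv_baseEquiv, baseEquiv_baseSharp, baseEquiv_baseSharp]
  have h1 := sharpAt_smul hP (a : G) ((1 : G) : G ⧸ H) (baseCovector F h η)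
  rw [mem_smul_mk_one a.2] at h1
  rw [h1]
  congr 2
  ext w
  obtain ⟨v, rfl⟩ := (baseEquiv F h).surjective w
  rw [ContinuousLinearMap.comp_apply, translationDeriv_baseEquiv, baseCovector_apply,
    baseCovector_apply, coAd_apply, LinearEquiv.symm_apply_apply, LinearEquiv.symm_apply_apply]

/-- Invariance of `π` moves the computation of `α^#` from `g • ē` to `ē`, where the pulled-back
covector is `F^α(g)`. -/
theorem sharpAt_eq_translationDeriv (hP : P.IsInvariant) (α : OneForm F (G ⧸ H)) (g : G) :
    P.sharpAt (g • ((1 : G) : G ⧸ H)) (α (g • ((1 : G) : G ⧸ H))) =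
      translationDeriv F g ((1 : G) : G ⧸ H)
        (baseEquiv F h (baseSharp h P (formFunction h α g))) := by
  refine (sharpAt_smul hP g _ _).trans (congrArg (translationDeriv F g ((1 : G) : G ⧸ H)) ?_)
  rw [baseEquiv_baseSharp]
  refine congrArg (P.sharpAt ((1 : G) : G ⧸ H)) (ContinuousLinearMap.ext fun w => ?_)
  obtain ⟨v, rfl⟩ := (baseEquiv F h).surjective w
  rw [baseCovector_apply, LinearEquiv.symm_apply_apply, formFunction_apply]
  rfl

/-- The `𝔪^*`-valued function `α^# · F^β` on `G`, translated from `ē`. -/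
def sharpDeriv (P : PoissonTensor F (G ⧸ H)) (α β : OneForm F (G ⧸ H)) (g : G) : Module.Dual ℝ 𝔪 :=
  formDeriv h β g (baseSharp h P (formFunction h α g))

theorem sharpDeriv_one_apply (α β : OneForm F (G ⧸ H)) (v : 𝔪) :
    sharpDeriv h P α β 1 v = dualDeriv ((baseTangentEquiv h).symm
      (P.sharp ((1 : G) : G ⧸ H) (α ((1 : G) : G ⧸ H)))) (formFunction h β) v := by
  have h1 : baseSharp h P (formFunction h α 1) =
      (baseEquiv F h).symm (P.sharpAt ((1 : G) : G ⧸ H) (α ((1 : G) : G ⧸ H))) := by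
    rw [formFunction_one]
    exact congrArg (fun ξ : F →L[ℝ] ℝ => (baseEquiv F h).symm (P.sharpAt ((1 : G) : G ⧸ H) ξ))
      (baseCovector_baseCotangent h _)
  rw [sharpDeriv, formDeriv_one_apply, h1]
  rfl

/-- The `Ad_a` acting on the direction in `formDeriv_mul_mem` cancels the `Ad_a^*` acting on `F^α`,
by invariance of `π`. -/
theorem sharpDeriv_mul_mem (hP : P.IsInvariant) (α β : OneForm F (G ⧸ H)) (g : G) (a : H) :
    sharpDeriv h P α β (g * a) = coAd h a (sharpDeriv h P α β g) := by
  rw [sharpDeriv, formDeriv_mul_mem, formFunction_mul_mem, adRestrict_baseSharp_coAd h hP]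
  rfl

theorem sharpDeriv_act (α β : OneForm F (G ⧸ H)) (g k : G) :
    sharpDeriv h P (act E F H g α) (act E F H g β) k = sharpDeriv h P α β (g⁻¹ * k) := by
  rw [sharpDeriv, formDeriv_act, formFunction_act]
  rfl

theorem sharpDeriv_add_left (α α' β : OneForm F (G ⧸ H)) (g : G) :
    sharpDeriv h P (α + α') β g = sharpDeriv h P α β g + sharpDeriv h P α' β g := by
  simp only [sharpDeriv, formFunction_add, map_add]

theorem sharpDeriv_add_right (α β β' : OneForm F (G ⧸ H)) (g : G) :
    sharpDeriv h P α (β + β') g = sharpDeriv h P α β g + sharpDeriv h P α β' g := by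
  simp only [sharpDeriv, formDeriv_add, LinearMap.add_apply]

theorem sharpDeriv_const_smul_left (c : ℝ) (α β : OneForm F (G ⧸ H)) (g : G) :
    sharpDeriv h P (c • α) β g = c • sharpDeriv h P α β g := by
  simp only [sharpDeriv, formFunction_const_smul, map_smul]

theorem sharpDeriv_const_smul_right (c : ℝ) (α β : OneForm F (G ⧸ H)) (g : G) :
    sharpDeriv h P α (c • β) g = c • sharpDeriv h P α β g := by
  simp only [sharpDeriv, formDeriv_const_smul, LinearMap.smul_apply]

theorem sharpDeriv_smul_left (f : C^∞⟮𝓘(ℝ, F), G ⧸ H; ℝ⟯) (α β : OneForm F (G ⧸ H)) (g : G) :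
    sharpDeriv h P (OneForm.smul f α) β g = f (g : G ⧸ H) • sharpDeriv h P α β g := by
  simp only [sharpDeriv, formFunction_smul, map_smul]

/-- The direction of differentiation projects to `α^#` at `gH`, so the extra term in the product
rule is the one a contravariant connection requires. -/
theorem sharpDeriv_smul_right (hP : P.IsInvariant) (f : C^∞⟮𝓘(ℝ, F), G ⧸ H; ℝ⟯)
    (α β : OneForm F (G ⧸ H)) (g : G) :
    sharpDeriv h P α (OneForm.smul f β) g = f (g : G ⧸ H) • sharpDeriv h P α β g +
      (dAt f (g : G ⧸ H) (P.sharp (g : G ⧸ H) (α (g : G ⧸ H)))) • formFunction h β g := by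
  have h1 := sharpAt_eq_translationDeriv h hP α g
  rw [sharpDeriv, formDeriv_smul, ← h1, smul_mk_one]
  rfl

/-- The direction varies with `g`; expanding `F^α(g)` in a dual basis reduces to derivatives in
fixed directions with smooth coefficients. -/
theorem contMDiff_sharpDeriv (α β : OneForm F (G ⧸ H)) (v : 𝔪) :
    ContMDiff 𝓘(ℝ, E) 𝓘(ℝ, ℝ) ∞ (fun g => sharpDeriv h P α β g v) := by
  have : FiniteDimensional ℝ 𝔪 := Module.Finite.equiv (baseEquiv F h).symm
  let b := Module.finBasis ℝ 𝔪
  have h1 : (fun g => sharpDeriv h P α β g v) = fun g =>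
      ∑ i, formFunction h α g (b i) * formDeriv h β g (baseSharp h P (b.coord i)) v := by
    ext g
    rw [sharpDeriv]
    conv_lhs => rw [← b.sum_dual_apply_smul_coord (formFunction h α g)]
    simp only [map_sum, map_smul, LinearMap.sum_apply, LinearMap.smul_apply, smul_eq_mul]
  rw [h1]
  intro g
  exact ContMDiffAt.sum fun i _ =>
    (contMDiff_formFunction h α _ g).mul (contMDiff_formDeriv h β _ v g)

theorem contMDiff_bilin_formFunction
    (b : Module.Dual ℝ 𝔪 →ₗ[ℝ] Module.Dual ℝ 𝔪 →ₗ[ℝ] Module.Dual ℝ 𝔪)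
    (α β : OneForm F (G ⧸ H)) (v : 𝔪) :
    ContMDiff 𝓘(ℝ, E) 𝓘(ℝ, ℝ) ∞ (fun g => b (formFunction h α g) (formFunction h β g) v) := by
  have : FiniteDimensional ℝ 𝔪 := Module.Finite.equiv (baseEquiv F h).symm
  let e := Module.finBasis ℝ 𝔪
  have h1 : (fun g => b (formFunction h α g) (formFunction h β g) v) = fun g =>
      ∑ i, ∑ j, formFunction h β g (e i) *
        (formFunction h α g (e j) * b (e.coord j) (e.coord i) v) := by
    ext g
    conv_lhs => rw [← e.sum_dual_apply_smul_coord (formFunction h α g),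
      ← e.sum_dual_apply_smul_coord (formFunction h β g)]
    simp only [map_sum, map_smul, LinearMap.sum_apply, LinearMap.smul_apply, smul_eq_mul,
      Finset.mul_sum]
  rw [h1]
  intro g
  exact ContMDiffAt.sum fun i _ => ContMDiffAt.sum fun j _ =>
    (contMDiff_formFunction h β _ g).mul ((contMDiff_formFunction h α _ g).mul contMDiffAt_const)

theorem translationDeriv_ext (g : G) {ξ ξ' : F →L[ℝ] ℝ}
    (hξ : ∀ v : 𝔪, ξ (translationDeriv F g ((1 : G) : G ⧸ H) (baseEquiv F h v)) =
      ξ' (translationDeriv F g ((1 : G) : G ⧸ H) (baseEquiv F h v))) : ξ = ξ' := by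
  ext w
  have h1 := hξ ((baseEquiv F h).symm (translationDeriv F g⁻¹ (g • ((1 : G) : G ⧸ H)) w))
  rwa [LinearEquiv.apply_symm_apply, translationDeriv_apply_inv E] at h1

/-! ### Invariant connections and bilinear maps -/

/-- `b` is the bilinear map of the connection `D`. -/
def ContravariantConnection.HasBilin (D : ContravariantConnection P)
    (b : Module.Dual ℝ 𝔪 →ₗ[ℝ] Module.Dual ℝ 𝔪 →ₗ[ℝ] Module.Dual ℝ 𝔪) : Prop :=
  ∀ (α β : OneForm F (G ⧸ H)), formFunction h (D.toFun α β) 1 =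
    b (formFunction h α 1) (formFunction h β 1) + sharpDeriv h P α β 1

variable {h}

/-- Invariance of `D` spreads the formula from `1` to all of `G`: apply it to `g⁻¹ • α` and `g⁻¹ •
β`. -/
theorem ContravariantConnection.HasBilin.formFunction_eq {D : ContravariantConnection P}
    (hD : D.IsInvariant E) {b : Module.Dual ℝ 𝔪 →ₗ[ℝ] Module.Dual ℝ 𝔪 →ₗ[ℝ] Module.Dual ℝ 𝔪}
    (hb : D.HasBilin h b) (α β : OneForm F (G ⧸ H)) (g : G) :
    formFunction h (D.toFun α β) g =
      b (formFunction h α g) (formFunction h β g) + sharpDeriv h P α β g := by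
  have h1 := hb (act E F H g⁻¹ α) (act E F H g⁻¹ β)
  rw [← hD] at h1
  simpa only [formFunction_act, sharpDeriv_act, inv_inv, mul_one] using h1

theorem ContravariantConnection.HasBilin.unique_left {D D' : ContravariantConnection P}
    (hD : D.IsInvariant E) (hD' : D'.IsInvariant E)
    {b : Module.Dual ℝ 𝔪 →ₗ[ℝ] Module.Dual ℝ 𝔪 →ₗ[ℝ] Module.Dual ℝ 𝔪}
    (hb : D.HasBilin h b) (hb' : D'.HasBilin h b) : D = D' := by
  have h1 : D.toFun = D'.toFun := by
    refine LinearMap.ext₂ fun α β => formFunction_injective h ?_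
    ext1 g
    rw [hb.formFunction_eq hD, hb'.formFunction_eq hD']
  cases D
  cases D'
  congr

variable (h)

/-- Evaluation of one-forms at `ē`. -/
def baseEval : OneForm F (G ⧸ H) →ₗ[ℝ] Module.Dual ℝ 𝔪 where
  toFun α := formFunction h α 1
  map_add' α β := formFunction_add h α β 1
  map_smul' c α := formFunction_const_smul h c α 1

theorem apply_eq_zero_of_baseEval_eq_zero {α : OneForm F (G ⧸ H)} (hα : baseEval h α = 0) :
    α ((1 : G) : G ⧸ H) = 0 := by
  have h1 : baseCotangent h (α ((1 : G) : G ⧸ H)) = 0 := (formFunction_one h α).symm.trans hα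
  have h2 := baseCovector_baseCotangent h (α ((1 : G) : G ⧸ H))
  rw [h1, map_zero] at h2
  exact h2.symm

variable [T2Space (G ⧸ H)]

theorem baseEval_surjective :
    Function.Surjective (baseEval h : OneForm F (G ⧸ H) →ₗ[ℝ] Module.Dual ℝ 𝔪) := by
  intro η
  obtain ⟨α, hα⟩ := OneForm.exists_apply_eq ((1 : G) : G ⧸ H) (baseCovector F h η)
  refine ⟨α, (formFunction_one h α).trans ?_⟩
  rw [hα]
  exact baseCotangent_baseCovector h η

variable {h} in
theorem ContravariantConnection.HasBilin.unique_right {D : ContravariantConnection P}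
    {b b' : Module.Dual ℝ 𝔪 →ₗ[ℝ] Module.Dual ℝ 𝔪 →ₗ[ℝ] Module.Dual ℝ 𝔪}
    (hb : D.HasBilin h b) (hb' : D.HasBilin h b') : b = b' := by
  refine LinearMap.ext₂ fun η ξ => ?_
  obtain ⟨α, rfl⟩ := baseEval_surjective (F := F) h η
  obtain ⟨β, rfl⟩ := baseEval_surjective (F := F) h ξ
  exact add_right_cancel ((hb α β).symm.trans (hb' α β))

/-- `D` and the derivative term obey the same Leibniz rule, so their difference `T` at `ē` is
tensorial in each argument and descends to the values of `α` and `β` at `ē`. -/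
theorem ContravariantConnection.exists_hasBilin (hP : P.IsInvariant)
    (D : ContravariantConnection P) : ∃ b, D.HasBilin h b := by
  let T : OneForm F (G ⧸ H) →ₗ[ℝ] OneForm F (G ⧸ H) →ₗ[ℝ] Module.Dual ℝ 𝔪 :=
    LinearMap.mk₂ ℝ (fun α β => formFunction h (D.toFun α β) 1 - sharpDeriv h P α β 1)
      (fun α α' β => by
        rw [LinearMap.map_add₂, formFunction_add, sharpDeriv_add_left]; abel)
      (fun c α β => by
        rw [LinearMap.map_smul₂, formFunction_const_smul, sharpDeriv_const_smul_left,
          smul_sub])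
      (fun α β β' => by
        rw [map_add, formFunction_add, sharpDeriv_add_right]; abel)
      (fun c α β => by
        rw [map_smul, formFunction_const_smul, sharpDeriv_const_smul_right, smul_sub])
  have hT (α β) : T α β = formFunction h (D.toFun α β) 1 - sharpDeriv h P α β 1 := rfl
  have hleft (α β) (hα : baseEval h α = 0) : T α β = 0 := by
    refine OneForm.eq_zero_of_tensorial (T.flip β) (fun f α => ?_)
      (apply_eq_zero_of_baseEval_eq_zero h hα)
    rw [LinearMap.flip_apply, LinearMap.flip_apply, hT, hT, D.smul_left, formFunction_smul,
      sharpDeriv_smul_left, smul_sub]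
  have hleibniz (f : C^∞⟮𝓘(ℝ, F), G ⧸ H; ℝ⟯) (α β : OneForm F (G ⧸ H)) :
      formFunction h (D.toFun α (OneForm.smul f β)) 1 =
        dAt f ((1 : G) : G ⧸ H) (P.sharp ((1 : G) : G ⧸ H) (α ((1 : G) : G ⧸ H))) •
          formFunction h β 1 + f ((1 : G) : G ⧸ H) • formFunction h (D.toFun α β) 1 := by
    rw [formFunction_one, D.leibniz, map_add, map_smul, map_smul, formFunction_one,
      formFunction_one]
  have hright (α β) (hβ : baseEval h β = 0) : T α β = 0 := by
    refine OneForm.eq_zero_of_tensorial (T α) (fun f β => ?_)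
      (apply_eq_zero_of_baseEval_eq_zero h hβ)
    rw [hT, hT, hleibniz, sharpDeriv_smul_right h hP, smul_sub]
    abel
  -- Any linear section `e` of the evaluation at `ē` will do, because `T` vanishes when either
  -- argument vanishes at `ē`.
  obtain ⟨e, he⟩ := LinearMap.exists_rightInverse_of_surjective (baseEval (F := F) h)
    (LinearMap.range_eq_top.2 (baseEval_surjective h))
  have he' (α : OneForm F (G ⧸ H)) : baseEval h (α - e (baseEval h α)) = 0 := by
    rw [map_sub, sub_eq_zero]
    exact (LinearMap.congr_fun he (baseEval h α)).symm
  refine ⟨T.compl₁₂ e e, fun α β => ?_⟩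
  have h1 := hleft _ β (he' α)
  have h2 := hright (e (baseEval h α)) _ (he' β)
  rw [map_sub, LinearMap.sub_apply, sub_eq_zero] at h1
  rw [map_sub, sub_eq_zero] at h2
  have h3 : T.compl₁₂ e e (formFunction h α 1) (formFunction h β 1) = T α β :=
    (h1.trans h2).symm
  rw [h3, hT, sub_add_cancel]

variable {h} in
-- Evaluate `F^{D_α β}` at `a ∈ H` both by equivariance from `1` and by the formula; the derivative
-- terms agree and cancel.
theorem ContravariantConnection.HasBilin.isAdInvariant (hP : P.IsInvariant)
    {D : ContravariantConnection P} (hD : D.IsInvariant E)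
    {b : Module.Dual ℝ 𝔪 →ₗ[ℝ] Module.Dual ℝ 𝔪 →ₗ[ℝ] Module.Dual ℝ 𝔪} (hb : D.HasBilin h b) :
    IsAdInvariant h b := by
  intro a η ξ
  obtain ⟨α, rfl⟩ := baseEval_surjective (F := F) h η
  obtain ⟨β, rfl⟩ := baseEval_surjective (F := F) h ξ
  have h1 := hb.formFunction_eq hD α β (1 * a)
  rw [sharpDeriv_mul_mem h hP, formFunction_mul_mem, formFunction_mul_mem, formFunction_mul_mem,
    hb.formFunction_eq hD, map_add] at h1
  exact add_right_cancel h1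

/-- Invariance of `b` makes the right-hand side equivariant, hence the function of a one-form; that
form is unique, so bilinearity can be checked on functions. -/
theorem exists_bilin_formFunction_eq (hP : P.IsInvariant)
    {b : Module.Dual ℝ 𝔪 →ₗ[ℝ] Module.Dual ℝ 𝔪 →ₗ[ℝ] Module.Dual ℝ 𝔪} (hb : IsAdInvariant h b) :
    ∃ Γ : OneForm F (G ⧸ H) →ₗ[ℝ] OneForm F (G ⧸ H) →ₗ[ℝ] OneForm F (G ⧸ H),
      ∀ α β g, formFunction h (Γ α β) g =
        b (formFunction h α g) (formFunction h β g) + sharpDeriv h P α β g := by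
  have hex (α β : OneForm F (G ⧸ H)) : ∃ γ : OneForm F (G ⧸ H), formFunction h γ =
      fun g => b (formFunction h α g) (formFunction h β g) + sharpDeriv h P α β g :=
    exists_formFunction_eq h
      (fun g a => by
        rw [formFunction_mul_mem, formFunction_mul_mem, ← hb, sharpDeriv_mul_mem h hP, map_add])
      (fun v => (contMDiff_bilin_formFunction h b α β v).add (contMDiff_sharpDeriv h α β v))
  choose γ hγ using hex
  have hγ' (α β : OneForm F (G ⧸ H)) (g : G) : formFunction h (γ α β) g =
      b (formFunction h α g) (formFunction h β g) + sharpDeriv h P α β g := congrFun (hγ α β) g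
  have hinj {θ₁ θ₂ : OneForm F (G ⧸ H)}
      (hθ : ∀ g, formFunction h θ₁ g = formFunction h θ₂ g) : θ₁ = θ₂ :=
    formFunction_injective h (funext hθ)
  refine ⟨LinearMap.mk₂ ℝ γ (fun α α' β => hinj fun g => ?_) (fun c α β => hinj fun g => ?_)
    (fun α β β' => hinj fun g => ?_) (fun c α β => hinj fun g => ?_), fun α β g => hγ' α β g⟩
  · rw [formFunction_add, hγ', hγ', hγ', formFunction_add, sharpDeriv_add_left, map_add,
      LinearMap.add_apply]
    abel
  · rw [formFunction_const_smul, hγ', hγ', formFunction_const_smul, sharpDeriv_const_smul_left,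
      map_smul, LinearMap.smul_apply, smul_add]
  · rw [formFunction_add, hγ', hγ', hγ', formFunction_add, sharpDeriv_add_right, map_add]
    abel
  · rw [formFunction_const_smul, hγ', hγ', formFunction_const_smul, sharpDeriv_const_smul_right,
      map_smul, smul_add]

/-- The Leibniz rule at `x` follows from the Leibniz rule for the functions on `G`. -/
theorem apply_eq_add_of_formFunction_eq {θ β γ : OneForm F (G ⧸ H)} {g : G} {c d : ℝ}
    (hθ : formFunction h θ g = c • formFunction h β g + d • formFunction h γ g) :
    θ (g : G ⧸ H) = c • β (g : G ⧸ H) + d • γ (g : G ⧸ H) := by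
  rw [← smul_mk_one]
  refine translationDeriv_ext (F := F) h g fun v => ?_
  refine (formFunction_apply h θ g v).symm.trans (Eq.trans ?_ (congrArg₂
    (fun r s : ℝ => c * r + d * s) (formFunction_apply h β g v) (formFunction_apply h γ g v)))
  rw [hθ, LinearMap.add_apply, LinearMap.smul_apply, LinearMap.smul_apply, smul_eq_mul, smul_eq_mul]

theorem exists_connection_of_isAdInvariant (hP : P.IsInvariant)
    {b : Module.Dual ℝ 𝔪 →ₗ[ℝ] Module.Dual ℝ 𝔪 →ₗ[ℝ] Module.Dual ℝ 𝔪} (hb : IsAdInvariant h b) :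
    ∃ D : ContravariantConnection P, D.IsInvariant E ∧ D.HasBilin h b := by
  obtain ⟨Γ, hΓ⟩ := exists_bilin_formFunction_eq h hP hb
  refine ⟨⟨Γ, fun f α β => formFunction_injective h (funext fun g => ?_), fun f α β x => ?_⟩,
    fun g α β => formFunction_injective h (funext fun k => ?_), fun α β => hΓ α β 1⟩
  · rw [formFunction_smul, hΓ, hΓ, formFunction_smul, sharpDeriv_smul_left, map_smul,
      LinearMap.smul_apply, smul_add]
  · obtain ⟨g, rfl⟩ := QuotientGroup.mk_surjective x
    refine apply_eq_add_of_formFunction_eq h ?_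
    rw [hΓ, hΓ, formFunction_smul, sharpDeriv_smul_right h hP, map_smul, smul_add]
    abel
  · change formFunction h (act E F H g (Γ α β)) k =
      formFunction h (Γ (act E F H g α) (act E F H g β)) k
    rw [formFunction_act, hΓ α β, hΓ (act E F H g α), formFunction_act, formFunction_act,
      sharpDeriv_act]

end Correspondence

end PoissonHomogeneous

end

theorem mainTheorem8
    {E F : Type*} [NormedAddCommGroup E] [NormedSpace ℝ E] [FiniteDimensional ℝ E]
    [NormedAddCommGroup F] [NormedSpace ℝ F] [FiniteDimensional ℝ F]
    {G : Type*} [TopologicalSpace G] [Group G] [ChartedSpace E G] [LieGroup 𝓘(ℝ, E) ∞ G]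
    [ConnectedSpace G]
    (H : Subgroup G) (hH : IsClosed (H : Set G))
    [ChartedSpace F (G ⧸ H)] [IsManifold 𝓘(ℝ, F) ∞ (G ⧸ H)] [IsQuotientManifold E F H]
    (𝔪 : Submodule ℝ (GroupLieAlgebra 𝓘(ℝ, E) G)) (h𝔪 : IsReductiveComplement H 𝔪)
    (P : PoissonTensor F (G ⧸ H)) (hP : P.IsInvariant) :
    ∃ Ψ : {D : ContravariantConnection P // D.IsInvariant E} ≃
        {b : Module.Dual ℝ 𝔪 →ₗ[ℝ] Module.Dual ℝ 𝔪 →ₗ[ℝ] Module.Dual ℝ 𝔪 // IsAdInvariant h𝔪 b},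
      ∀ (D : {D : ContravariantConnection P // D.IsInvariant E}) (α β : OneForm F (G ⧸ H)) (v : 𝔪),
        baseCotangent h𝔪 (D.1.toFun α β ((1 : G) : G ⧸ H)) v =
          (Ψ D).1 (baseCotangent h𝔪 (α ((1 : G) : G ⧸ H))) (baseCotangent h𝔪 (β ((1 : G) : G ⧸ H))) v
            + dualDeriv
                ((baseTangentEquiv h𝔪).symm
                  (P.sharp ((1 : G) : G ⧸ H) (α ((1 : G) : G ⧸ H))))
                (formFunction h𝔪 β) v := by
  -- For a topological group and a closed subgroup the quotient is Hausdorff, which the bump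
  -- functions on `G ⧸ H` need.
  have : IsTopologicalGroup G := topologicalGroup_of_lieGroup 𝓘(ℝ, E) ∞
  have : IsClosed (H : Set G) := hH
  have hiff (D : ContravariantConnection P)
      (b : Module.Dual ℝ 𝔪 →ₗ[ℝ] Module.Dual ℝ 𝔪 →ₗ[ℝ] Module.Dual ℝ 𝔪) :
      D.HasBilin h𝔪 b ↔ ∀ (α β : OneForm F (G ⧸ H)) (v : 𝔪),
        baseCotangent h𝔪 (D.toFun α β ((1 : G) : G ⧸ H)) v =
          b (baseCotangent h𝔪 (α ((1 : G) : G ⧸ H))) (baseCotangent h𝔪 (β ((1 : G) : G ⧸ H))) v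
            + dualDeriv ((baseTangentEquiv h𝔪).symm
                (P.sharp ((1 : G) : G ⧸ H) (α ((1 : G) : G ⧸ H)))) (formFunction h𝔪 β) v := by
    refine forall₂_congr fun α β => LinearMap.ext_iff.trans (forall_congr' fun v => ?_)
    rw [LinearMap.add_apply, sharpDeriv_one_apply, formFunction_one, formFunction_one,
      formFunction_one]
  choose b hb using fun D : ContravariantConnection P =>
    ContravariantConnection.exists_hasBilin h𝔪 hP D
  refine ⟨Equiv.ofBijective (fun D => ⟨b D.1, (hb D.1).isAdInvariant hP D.2⟩) ⟨?_, ?_⟩,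
    fun D => (hiff D.1 _).1 (hb D.1)⟩
  · intro D D' hDD'
    have h1 : b D.1 = b D'.1 := congrArg Subtype.val hDD'
    exact Subtype.ext (ContravariantConnection.HasBilin.unique_left D.2 D'.2 (hb D.1)
      (h1 ▸ hb D'.1))
  · rintro ⟨b', hb'⟩
    obtain ⟨D, hD, hDb⟩ := exists_connection_of_isAdInvariant h𝔪 hP hb'
    -- The bilinear map chosen for `D` has to be `b'`, since a connection determines its bilinear
    -- map.
    exact ⟨⟨D, hD⟩, Subtype.ext ((hb D).unique_right hDb)⟩
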